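/- All rings are associative with identity. For right modules over a ring $R$, define classes $\mathcal K_\alpha$, for $\alpha=-1$ and for every ordinal $\alpha$ (where $-1$ is regarded as smaller than every ordinal), by induction: $\mathcal K_{-1}$ consists of the zero modules, and for an ordinal $\alpha\ge 0$ a module $M$ belongs to $\mathcal K_\alpha$ if and only if, for every descending chain $M_0\supseteq M_1\supseteq M_2\supseteq\cdots$ of submodules of $M$, one has $M_i/M_{i+1}\in\bigcup_{\beta<\alpha}\mathcal K_\beta$ for all but finitely many $i$. If $M$ lies in some $\mathcal K_\alpha$, its Krull dimension $\operatorname{Kdim}(M)$ is the least such $\alpha$; otherwise the Krull dimension of $M$ does not exist. A ring $R$ has right Krull dimension if $\operatorname{Kdim}(R_R)$ exists, and then $\operatorname{rKdim}(R)=\operatorname{Kdim}(R_R)$. A ring $S$ satisfies left ACC-reg if it satisfies the ascending chain condition on left ideals of the form $Ss$ with $s\in S$ a regular element (neither a left nor a right zero divisor). The prime radical of a ring is the intersection of its prime (two-sided) ideals. **Corollary 7.6.** Let $R$ be a ring with right Krull dimension, and let $N$ be its prime radical. Suppose that one of the following two conditions holds: (A) $R/N$ satisfies left ACC-reg; (B)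 $R/P$ satisfies left ACC-reg for every minimal prime ideal $P$ of $R$. If all maximal right ideals of $R$ are principal (of the form $aR$ with $a \in R$), then $\operatorname{rKdim}(R)\le 1$. In particular, if $R$ is a (left and right) noetherian ring whose maximal right ideals are all principal, then $R$ has right Krull dimension and $\operatorname{rKdim}(R)\le 1$. -/

import Mathlib

universe u v

/-- The class `𝒦_α` of Gabriel–Rentschler, for `α` an ordinal or `-1` (written `⊥`):
`𝒦_{-1}` consists of the zero modules; for an ordinal `α`, a module `M` is in `𝒦_α` when in every
descending chain `M₀ ⊇ M₁ ⊇ ⋯` of submodules all but finitely many factors `Mᵢ / Mᵢ₊₁` lie in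
`⋃_{β < α} 𝒦_β` (here `β = -1` is allowed). -/
def KrullClass (S : Type u) [Ring S] (α : WithBot Ordinal.{v})
    (M : Type v) [AddCommGroup M] [Module S M] : Prop :=
  (α = ⊥ ∧ Subsingleton M) ∨
  (α ≠ ⊥ ∧ ∀ c : ℕ → Submodule S M, Antitone c →
    ∃ n : ℕ, ∀ i ≥ n, ∃ β : WithBot Ordinal.{v}, ∃ _hβ : β < α,
      KrullClass S β (↥(c i) ⧸ (c (i + 1)).submoduleOf (c i)))
termination_by (wellFounded_lt (α := WithBot Ordinal.{v})).wrap α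
decreasing_by assumption

/-- The Krull dimension of the module `M` exists. -/
def HasKdim (S : Type u) [Ring S] (M : Type v) [AddCommGroup M] [Module S M] : Prop :=
  ∃ α : WithBot Ordinal.{v}, KrullClass S α M

/-- The Krull dimension of a module whose Krull dimension exists: the least `α` (an ordinal or
`-1 = ⊥`) such that `M` belongs to `𝒦_α`. -/
noncomputable def Kdim (S : Type u) [Ring S] (M : Type v) [AddCommGroup M] [Module S M]
    (h : HasKdim S M) : WithBot Ordinal.{v} :=
  (wellFounded_lt (α := WithBot Ordinal.{v})).min {α | KrullClass S α M} h

/-- The ring `R` has right Krull dimension. Right `R`-modules are modules over `Rᵐᵒᵖ`,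
so `R_R` is `R` as a module over `Rᵐᵒᵖ`. -/
def HasRightKdim (R : Type u) [Ring R] : Prop :=
  HasKdim Rᵐᵒᵖ R

/-- The right Krull dimension of `R`, i.e. the Krull dimension of `R_R`. -/
noncomputable def rKdim (R : Type u) [Ring R] (h : HasRightKdim R) : WithBot Ordinal.{u} :=
  Kdim Rᵐᵒᵖ R h

/-- A prime ideal of a (not necessarily commutative) ring: a proper two-sided ideal `P` such that
`I J ⊆ P` implies `I ⊆ P` or `J ⊆ P` for all two-sided ideals `I`, `J`. -/
def IsPrimeTwoSided {R : Type u} [Ring R] (P : TwoSidedIdeal R) : Prop :=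
  P ≠ ⊤ ∧ ∀ I J : TwoSidedIdeal R, (∀ x ∈ I, ∀ y ∈ J, x * y ∈ P) → I ≤ P ∨ J ≤ P

/-- A minimal prime ideal of `R`. -/
def IsMinimalPrimeTwoSided {R : Type u} [Ring R] (P : TwoSidedIdeal R) : Prop :=
  Minimal IsPrimeTwoSided P

/-- The prime radical of `R`: the intersection of all prime ideals. -/
def primeRadical (R : Type u) [Ring R] : TwoSidedIdeal R :=
  sInf {P : TwoSidedIdeal R | IsPrimeTwoSided P}

/-- Left ACC-reg: the ascending chain condition on left ideals of the form `R s` with `s` a regular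
element (`Ideal R` is the type of left ideals). -/
def LeftACCReg (R : Type u) [Ring R] : Prop :=
  ∀ s : ℕ → R, (∀ n, IsRegular (s n)) → Monotone (fun n => Ideal.span {s n}) →
    ∃ n, ∀ m ≥ n, Ideal.span {s m} = Ideal.span {s n}

/-- Every maximal right ideal of `R` is principal, i.e. of the form `a R`. Right ideals are
`Rᵐᵒᵖ`-submodules of `R`. -/
def MaximalRightIdealsPrincipal (R : Type u) [Ring R] : Prop :=
  ∀ m : Submodule Rᵐᵒᵖ R, IsCoatom m → ∃ a : R, m = Submodule.span Rᵐᵒᵖ {a}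

/-! ### Deviation of partially ordered sets -/

section Deviation

/-! Krull dimension is the deviation of the submodule lattice, and deviation at most 0 is the
descending chain condition. Existence of a deviation is used mostly negatively: the power set of ℕ
has none, so it cannot embed in the lattice of right ideals.

Semiprime case. Existence of the deviation gives Goldie's theorem: essential right ideals contain
regular elements (`IsEssentialRight.exists_isRegular_mem`). If E is essential and R/E is not
artinian, choose a regular d in E and a maximal right ideal aR containing E, and write d = ad'. Then
E' = {r | ar ∈ E} is essential, contains the regular element d', and R/E' ≅ aR/E is still not
artinian, since R/aR is simple. Iterating yields an ascending chain Rd ≤ Rd' ≤ ⋯; where it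
stabilizes, a is invertible, which is absurd. So every R/E with E essential is artinian. In a
descending chain of right ideals each term is eventually essential in its predecessor, so the
factors are locally artinian, hence artinian, and R has deviation at most 1.

General case. Let T be the set of x for which xR has deviation at most 1. This bound is a local
property once the deviation exists (`devLE_of_locDevLE_succ`), so T has deviation at most 1. If T ≠
R, then R/T has a nonzero element killed by a prime P (`exists_isPrimeTwoSided_annihilates`). As R/P
is a quotient of R/N, and of R/Q for some minimal prime Q, the semiprime case bounds R/P and forces
that element into T. Nilpotence of N is not needed. -/

/-- The interval `[a, b]` of a partial order has deviation at most `α`, where `α` is an ordinal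
or `-1 = ⊥`. -/
def DevLE {L : Type*} [PartialOrder L] (α : WithBot Ordinal.{v}) (a b : L) : Prop :=
  (α = ⊥ ∧ ¬ a < b) ∨
  (α ≠ ⊥ ∧ ∀ c : ℕ → L, Antitone c → (∀ i, a ≤ c i ∧ c i ≤ b) →
    ∃ n : ℕ, ∀ i ≥ n, ∃ β : WithBot Ordinal.{v}, ∃ _hβ : β < α, DevLE β (c (i + 1)) (c i))
termination_by (wellFounded_lt (α := WithBot Ordinal.{v})).wrap α
decreasing_by assumption

/-- The interval `[a, b]` has deviation less than `α`. -/
def DevLT {L : Type*} [PartialOrder L] (α : WithBot Ordinal.{v}) (a b : L) : Prop :=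
  ∃ β < α, DevLE β a b

variable {L L' : Type*}

theorem devLE_bot [PartialOrder L] {a b : L} : DevLE (⊥ : WithBot Ordinal.{v}) a b ↔ ¬ a < b := by
  rw [DevLE]; simp

theorem devLE_iff [PartialOrder L] {α : WithBot Ordinal.{v}} (hα : α ≠ ⊥) {a b : L} :
    DevLE α a b ↔ ∀ c : ℕ → L, Antitone c → (∀ i, a ≤ c i ∧ c i ≤ b) →
      ∃ n : ℕ, ∀ i ≥ n, DevLT α (c (i + 1)) (c i) := by
  rw [DevLE]; simp [hα, DevLT]

/-- A chain is carried to a chain with strict steps preserved. All later comparisons of factors use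
such maps; no lattice isomorphism is needed. -/
theorem DevLE.of_strictMonoOn [PartialOrder L] [PartialOrder L'] {α : WithBot Ordinal.{v}}
    {a b : L} {f : L → L'} (hf : StrictMonoOn f (Set.Icc a b)) (h : DevLE α (f a) (f b)) :
    DevLE α a b := by
  induction α using WellFoundedLT.induction generalizing a b with
  | ind α ih =>
    by_cases hα : α = ⊥
    · subst hα
      rw [devLE_bot] at h ⊢
      exact fun hab => h (hf ⟨le_rfl, hab.le⟩ ⟨hab.le, le_rfl⟩ hab)
    · rw [devLE_iff hα] at h ⊢
      intro c hc hcab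
      have hab : a ≤ b := (hcab 0).1.trans (hcab 0).2
      obtain ⟨n, hn⟩ := h (fun i => f (c i))
        (fun i j hij => hf.monotoneOn (hcab j) (hcab i) (hc hij))
        (fun i => ⟨hf.monotoneOn ⟨le_rfl, hab⟩ (hcab i) (hcab i).1,
          hf.monotoneOn (hcab i) ⟨hab, le_rfl⟩ (hcab i).2⟩)
      refine ⟨n, fun i hi => ?_⟩
      obtain ⟨β, hβ, hd⟩ := hn i hi
      exact ⟨β, hβ, ih β hβ (hf.mono (Set.Icc_subset_Icc (hcab _).1 (hcab _).2)) hd⟩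

theorem devLE_of_not_lt [PartialOrder L] {a b : L} (α : WithBot Ordinal.{v}) (h : ¬ a < b) :
    DevLE α a b := by
  by_cases hα : α = ⊥
  · subst hα; exact devLE_bot.2 h
  · rw [devLE_iff hα]
    intro c hc hcab
    have hab : a = b := ((hcab 0).1.trans (hcab 0).2).eq_of_not_lt h
    refine ⟨0, fun i _ => ⟨⊥, bot_lt_iff_ne_bot.2 hα, devLE_bot.2 fun hlt => ?_⟩⟩
    subst hab
    exact (hlt.trans_le (hcab i).2).not_ge (hcab (i + 1)).1

theorem devLE_refl [PartialOrder L] (α : WithBot Ordinal.{v}) (a : L) : DevLE α a a :=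
  devLE_of_not_lt α (lt_irrefl a)

theorem DevLE.mono [PartialOrder L] {α β : WithBot Ordinal.{v}} {a b : L} (h : DevLE α a b)
    (hαβ : α ≤ β) : DevLE β a b := by
  by_cases hα : α = ⊥
  · subst hα; exact devLE_of_not_lt β (devLE_bot.1 h)
  · have hβ : β ≠ ⊥ := fun hb => hα (by rw [hb] at hαβ; exact le_bot_iff.1 hαβ)
    rw [devLE_iff hα] at h
    rw [devLE_iff hβ]
    intro c hc hcab
    obtain ⟨n, hn⟩ := h c hc hcab
    refine ⟨n, fun i hi => ?_⟩
    obtain ⟨γ, hγ, hd⟩ := hn i hi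
    exact ⟨γ, hγ.trans_le hαβ, hd⟩

theorem DevLE.sub [PartialOrder L] {α : WithBot Ordinal.{v}} {a b a' b' : L} (h : DevLE α a b)
    (ha : a ≤ a') (hb : b' ≤ b) : DevLE α a' b' := by
  by_cases hα : α = ⊥
  · subst hα
    rw [devLE_bot] at h ⊢
    exact fun hlt => h (ha.trans_lt (hlt.trans_le hb))
  · rw [devLE_iff hα] at h ⊢
    exact fun c hc hcab => h c hc fun i => ⟨ha.trans (hcab i).1, (hcab i).2.trans hb⟩

theorem DevLE.prod [PartialOrder L] [PartialOrder L'] {α : WithBot Ordinal.{v}}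
    {a b : L} {a' b' : L'} (h : DevLE α a b) (h' : DevLE α a' b') :
    DevLE α (a, a') (b, b') := by
  induction α using WellFoundedLT.induction generalizing a b a' b' with
  | ind α ih =>
    by_cases hα : α = ⊥
    · subst hα
      rw [devLE_bot] at h h' ⊢
      intro hlt
      rw [Prod.lt_iff] at hlt
      rcases hlt with hlt | hlt
      · exact h hlt.1
      · exact h' hlt.2
    · rw [devLE_iff hα] at h h' ⊢
      intro c hc hcab
      obtain ⟨n, hn⟩ := h (fun i => (c i).1) (fun i j hij => (hc hij).1)
        (fun i => ⟨(hcab i).1.1, (hcab i).2.1⟩)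
      obtain ⟨n', hn'⟩ := h' (fun i => (c i).2) (fun i j hij => (hc hij).2)
        (fun i => ⟨(hcab i).1.2, (hcab i).2.2⟩)
      refine ⟨max n n', fun i hi => ?_⟩
      obtain ⟨β, hβ, hd⟩ := hn i (le_of_max_le_left hi)
      obtain ⟨β', hβ', hd'⟩ := hn' i (le_of_max_le_right hi)
      exact ⟨max β β', max_lt hβ hβ', ih _ (max_lt hβ hβ') (hd.mono (le_max_left _ _))
        (hd'.mono (le_max_right _ _))⟩

section Modular

variable [Lattice L] [IsModularLattice L]

/-- In a modular lattice x ↦ (x ⊓ b, x ⊔ b) is strictly monotone, so [a, c] maps into [a, b] × [b,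
c]. -/
theorem DevLE.trans {α : WithBot Ordinal.{v}} {a b c : L} (hab : a ≤ b) (hbc : b ≤ c)
    (h : DevLE α a b) (h' : DevLE α b c) : DevLE α a c := by
  refine DevLE.of_strictMonoOn (f := fun x => (x ⊓ b, x ⊔ b))
    ((strictMono_inf_prod_sup (z := b)).strictMonoOn _) ?_
  have h1 : a ⊓ b = a := inf_eq_left.2 hab
  have h2 : a ⊔ b = b := sup_eq_right.2 hab
  have h3 : c ⊓ b = b := inf_eq_right.2 hbc
  have h4 : c ⊔ b = c := sup_eq_left.2 hbc
  simp only [h1, h2, h3, h4]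
  exact h.prod h'

theorem DevLE.sup_of_inf {α : WithBot Ordinal.{v}} {a b : L} (h : DevLE α (a ⊓ b) a) :
    DevLE α b (a ⊔ b) := by
  refine DevLE.of_strictMonoOn (f := fun x => a ⊓ x) ?_ ?_
  · intro x hx y hy hxy
    refine lt_of_le_of_ne (inf_le_inf_left a hxy.le) fun he => hxy.ne ?_
    have key : ∀ z ∈ Set.Icc b (a ⊔ b), (a ⊓ z) ⊔ b = z := fun z hz => by
      rw [inf_comm, inf_sup_assoc_of_le _ hz.1, inf_eq_left.2 hz.2]
    have he' : a ⊓ x = a ⊓ y := he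
    rw [← key x hx, ← key y hy, he']
  · simpa using h

theorem DevLE.inf_of_sup {α : WithBot Ordinal.{v}} {a b : L} (h : DevLE α b (a ⊔ b)) :
    DevLE α (a ⊓ b) a := by
  refine DevLE.of_strictMonoOn (f := fun x => x ⊔ b) ?_ ?_
  · intro x hx y hy hxy
    refine lt_of_le_of_ne (sup_le_sup_right hxy.le b) fun he => hxy.ne ?_
    have key : ∀ z ∈ Set.Icc (a ⊓ b) a, (z ⊔ b) ⊓ a = z := fun z hz => by
      rw [sup_inf_assoc_of_le _ hz.2, inf_comm, sup_eq_left.2 hz.1]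
    have he' : x ⊔ b = y ⊔ b := he
    rw [← key x hx, ← key y hy, he']
  · simpa [sup_eq_right.2 (inf_le_right : a ⊓ b ≤ b)] using h

theorem DevLT.trans {α : WithBot Ordinal.{v}} {a b c : L} (hab : a ≤ b) (hbc : b ≤ c)
    (h : DevLT α a b) (h' : DevLT α b c) : DevLT α a c := by
  obtain ⟨β, hβ, hd⟩ := h
  obtain ⟨β', hβ', hd'⟩ := h'
  exact ⟨max β β', max_lt hβ hβ', (hd.mono (le_max_left _ _)).trans hab hbc
    (hd'.mono (le_max_right _ _))⟩

end Modular

/-- Splitting repeatedly gives a descending chain all of whose factors satisfy p. One of them has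
smaller deviation, so induction applies. -/
theorem not_of_forall_split [PartialOrder L] {p : L → L → Prop} (hlt : ∀ a b, p a b → a < b)
    (hsplit : ∀ a b, p a b → ∃ c, p a c ∧ p c b) {α : WithBot Ordinal.{v}} {a b : L}
    (h : DevLE α a b) : ¬ p a b := by
  induction α using WellFoundedLT.induction generalizing a b with
  | ind α ih =>
    intro hp
    by_cases hα : α = ⊥
    · subst hα
      exact devLE_bot.1 h (hlt a b hp)
    · choose g hg using hsplit
      let s : ℕ → {x // p a x} := fun n => Nat.rec ⟨b, hp⟩ (fun _ x => ⟨g a x x.2, (hg a x x.2).1⟩) n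
      have hs : ∀ n, p (s (n + 1)).1 (s n).1 := fun n => (hg a (s n).1 (s n).2).2
      have hanti : Antitone fun n => (s n).1 := antitone_nat_of_succ_le fun n => (hlt _ _ (hs n)).le
      obtain ⟨n, hn⟩ := (devLE_iff hα).1 h (fun n => (s n).1) hanti
        fun i => ⟨(hlt _ _ (s i).2).le, hanti (Nat.zero_le i)⟩
      obtain ⟨β, hβ, hd⟩ := hn n le_rfl
      exact ih β hβ hd (hs n)

theorem not_devLE_of_strictMono_set [PartialOrder L] {f : Set ℕ → L} (hf : StrictMono f)
    (α : WithBot Ordinal.{v}) : ¬ DevLE α (f ∅) (f Set.univ) := by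
  intro h
  refine not_of_forall_split (p := fun A B : Set ℕ => A ⊆ B ∧ (B \ A).Infinite) ?_ ?_
    (DevLE.of_strictMonoOn (hf.strictMonoOn _) h) ⟨Set.empty_subset _, by
      simpa using Set.infinite_univ⟩
  · rintro A B ⟨hAB, hinf⟩
    refine lt_of_le_of_ne hAB fun he => ?_
    subst he
    simp at hinf
  · rintro A B ⟨hAB, hinf⟩
    let e := hinf.natEmbedding
    have he : ∀ n, (e n : ℕ) ∈ B \ A := fun n => (e n).2
    have hinj : Function.Injective fun n => (e n : ℕ) :=
      Subtype.val_injective.comp e.injective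
    -- Enumerate B \ A and add the even-indexed half to A; both differences stay infinite.
    refine ⟨A ∪ Set.range fun n => (e (2 * n) : ℕ), ⟨Set.subset_union_left, ?_⟩, ?_, ?_⟩
    · refine (Set.infinite_range_of_injective (f := fun n => (e (2 * n) : ℕ))
        fun m n hmn => ?_).mono ?_
      · have := hinj hmn; omega
      · rintro _ ⟨n, rfl⟩
        exact ⟨Or.inr ⟨n, rfl⟩, (he _).2⟩
    · rintro x (hx | ⟨n, rfl⟩)
      · exact hAB hx
      · exact (he _).1
    · refine (Set.infinite_range_of_injective (f := fun n => (e (2 * n + 1) : ℕ))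
        fun m n hmn => ?_).mono ?_
      · have := hinj hmn; omega
      · rintro _ ⟨n, rfl⟩
        refine ⟨(he _).1, ?_⟩
        rintro (hx | ⟨m, hm⟩)
        · exact (he _).2 hx
        · have := hinj hm; omega

/-- `c` is critical above `a`: for some `γ`, no `[a, d]` with `a < d ≤ c` has deviation `< γ`, but
all `[d, c]` have. -/
def IsCriticalAbove [PartialOrder L] (γ : WithBot Ordinal.{v}) (a c : L) : Prop :=
  a < c ∧ ∀ d, a < d → d ≤ c → ¬ DevLT γ a d ∧ DevLT γ d c

/-- Take γ least among the deviations of nontrivial intervals [a, c] below b. If no interval were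
critical, one could descend forever through factors of deviation not below γ. -/
theorem exists_isCriticalAbove [PartialOrder L] {α : WithBot Ordinal.{v}} {a b : L}
    (h : DevLE α a b) (hab : a < b) :
    ∃ γ : WithBot Ordinal.{v}, ∃ c ≤ b, IsCriticalAbove γ a c := by
  let P : Set (WithBot Ordinal.{v}) := {γ | ∃ c, a < c ∧ c ≤ b ∧ DevLE γ a c}
  have hP : P.Nonempty := ⟨α, b, hab, le_rfl, h⟩
  obtain ⟨γ, ⟨c, hac, hcb, hγ⟩, hmin⟩ := WellFounded.has_min wellFounded_lt P hP
  have hmin' : ∀ d, a < d → d ≤ b → ¬ DevLT γ a d := by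
    rintro d had hdb ⟨β, hβ, hd⟩
    exact hmin β ⟨d, had, hdb, hd⟩ hβ
  by_contra! hcon
  have hstep : ∀ c', a < c' ∧ c' ≤ c → ∃ d, (a < d ∧ d ≤ c) ∧ d ≤ c' ∧ ¬ DevLT γ d c' := by
    rintro c' ⟨hac', hc'⟩
    have := hcon γ c' (hc'.trans hcb)
    simp only [IsCriticalAbove, not_and, not_forall] at this
    obtain ⟨d, had, hdc, hd⟩ := this hac'
    exact ⟨d, ⟨had, hdc.trans hc'⟩, hdc,
      fun hlt => hd (hmin' d had ((hdc.trans hc').trans hcb)) hlt⟩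
  have hγ0 : γ ≠ ⊥ := by
    rintro rfl
    exact devLE_bot.1 hγ hac
  choose g hg1 hg2 hg3 using hstep
  let s : ℕ → {x // a < x ∧ x ≤ c} := fun n =>
    Nat.rec ⟨c, hac, le_rfl⟩ (fun _ x => ⟨g x x.2, hg1 x x.2⟩) n
  have hanti : Antitone fun n => (s n).1 := antitone_nat_of_succ_le fun n => hg2 _ (s n).2
  obtain ⟨n, hn⟩ := (devLE_iff hγ0).1 hγ (fun n => (s n).1) hanti
    fun i => ⟨(s i).2.1.le, (s i).2.2⟩
  exact hg3 _ (s n).2 (hn n le_rfl)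

end Deviation

/-! ### Independent families and eventually essential chains -/

section Module

variable {S : Type*} [Ring S] {M : Type*} [AddCommGroup M] [Module S M]

theorem disjoint_biSup_of_antitone {X D : ℕ → Submodule S M} (hX : Antitone X)
    (hDX : ∀ k, D k ≤ X k) (hdisj : ∀ k, D k ⊓ X (k + 1) = ⊥) {A : Set ℕ} {i : ℕ} (hi : i ∉ A) :
    D i ⊓ ⨆ j ∈ A, D j = ⊥ := by
  -- The indices below i are added one at a time, downwards from i: in a sum y + z in D i with y ∈ D
  -- k and z ∈ X (k + 1), y also lies in X (k + 1), so y = 0.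
  have key : ∀ m k, k + m = i → D i ⊓ ((⨆ j ∈ A ∩ Set.Ico k i, D j) ⊔ X (i + 1)) = ⊥ := by
    intro m
    induction m with
    | zero =>
      rintro k rfl
      simpa using hdisj k
    | succ m ih =>
      intro k hk
      have ih' := ih (k + 1) (by omega)
      rw [eq_bot_iff, ← ih']
      rintro x ⟨hxi, hx⟩
      have hle : (⨆ j ∈ A ∩ Set.Ico k i, D j) ⊔ X (i + 1) ≤
          D k ⊔ ((⨆ j ∈ A ∩ Set.Ico (k + 1) i, D j) ⊔ X (i + 1)) := by
        refine sup_le (iSup₂_le fun j hj => ?_) (le_sup_right.trans le_sup_right)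
        rcases hj.2.1.eq_or_lt with rfl | hlt
        · exact le_sup_left
        · exact le_sup_of_le_right (le_sup_of_le_left (le_iSup₂_of_le j ⟨hj.1, hlt, hj.2.2⟩ le_rfl))
      obtain ⟨y, hy, z, hz, rfl⟩ := Submodule.mem_sup.1 (hle hx)
      have hz' : z ∈ X (k + 1) := by
        refine sup_le (iSup₂_le fun j hj => ?_) (hX (by omega)) hz
        exact (hDX j).trans (hX hj.2.1)
      have hyX : y ∈ X (k + 1) := by
        have := (X (k + 1)).sub_mem (hX (by omega : k + 1 ≤ i) (hDX i hxi)) hz'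
        rwa [add_sub_cancel_right] at this
      have hy0 : y = 0 := by
        have : y ∈ D k ⊓ X (k + 1) := ⟨hy, hyX⟩
        simpa [hdisj k] using this
      subst hy0
      rw [zero_add] at hxi ⊢
      exact ⟨hxi, hz⟩
  rw [eq_bot_iff, ← key i 0 (by omega)]
  refine inf_le_inf_left _ (iSup₂_le fun j hj => ?_)
  rcases lt_trichotomy j i with h | h | h
  · exact le_sup_of_le_left (le_iSup₂_of_le j ⟨hj, Nat.zero_le _, h⟩ le_rfl)
  · exact absurd (h ▸ hj) hi
  · exact ((hDX j).trans (hX h)).trans le_sup_right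

theorem not_devLE_of_antitone {X D : ℕ → Submodule S M} (hX : Antitone X)
    (hDX : ∀ k, D k ≤ X k) (hD : ∀ k, D k ≠ ⊥) (hdisj : ∀ k, D k ⊓ X (k + 1) = ⊥)
    (α : WithBot Ordinal.{v}) : ¬ DevLE α (⊥ : Submodule S M) ⊤ := by
  intro h
  refine not_devLE_of_strictMono_set (f := fun A : Set ℕ => ⨆ j ∈ A, D j) ?_ α
    (h.sub bot_le le_top)
  intro A B hAB
  refine lt_of_le_of_ne (biSup_mono hAB.le) fun he => ?_
  obtain ⟨i, hiB, hiA⟩ := Set.exists_of_ssubset hAB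
  have he' : ⨆ j ∈ A, D j = ⨆ j ∈ B, D j := he
  have h1 : D i ≤ ⨆ j ∈ A, D j := he' ▸ le_iSup₂_of_le i hiB le_rfl
  exact hD i (by rw [← disjoint_biSup_of_antitone hX hDX hdisj hiA]; exact (inf_eq_left.2 h1).symm)

/-- Otherwise infinitely many steps X i ⊇ X (i + 1) have a nonzero complement-like D, and these D
form an infinite independent family, whose partial sums embed the power set of ℕ. -/
theorem exists_forall_essential {α : WithBot Ordinal.{v}} (h : DevLE α (⊥ : Submodule S M) ⊤)
    {X : ℕ → Submodule S M} (hX : Antitone X) :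
    ∃ n, ∀ i ≥ n, ∀ D ≤ X i, D ⊓ X (i + 1) = ⊥ → D = ⊥ := by
  by_contra! hcon
  choose g hg1 D hg2 hg3 hg4 using hcon
  let s : ℕ → ℕ := fun n => Nat.rec (g 0) (fun _ m => g (m + 1)) n
  have hs : ∀ n, s n + 1 ≤ s (n + 1) := fun n => hg1 (s n + 1)
  have hsm : StrictMono s := strictMono_nat_of_lt_succ fun n => hs n
  let t : ℕ → ℕ := fun n => Nat.casesOn n 0 (fun m => s m + 1)
  have ht : ∀ n, s n = g (t n) := fun n => by cases n <;> rfl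
  refine not_devLE_of_antitone (X := fun k => X (s k)) (D := fun k => D (t k))
    (fun i j hij => hX (hsm.monotone hij)) (fun k => ?_) (fun k => hg4 _) (fun k => ?_) α h
  · simpa only [ht] using hg2 (t k)
  · rw [eq_bot_iff, ← hg3 (t k), ← ht]
    exact inf_le_inf_left _ (hX (hs k))

end Module

/-! ### Krull dimension as deviation of the submodule lattice -/

section Krull

theorem krullClass_iff_devLE {S : Type u} [Ring S] (α : WithBot Ordinal.{v})
    {M : Type v} [AddCommGroup M] [Module S M] :
    KrullClass S α M ↔ DevLE α (⊥ : Submodule S M) ⊤ := by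
  induction α using WellFoundedLT.induction generalizing M with
  | ind α ih =>
    by_cases hα : α = ⊥
    · subst hα
      rw [KrullClass, devLE_bot, not_bot_lt_iff, eq_comm (a := (⊤ : Submodule S M)),
        subsingleton_iff_bot_eq_top (α := Submodule S M), Submodule.subsingleton_iff]
      simp
    · rw [KrullClass, devLE_iff hα]
      simp only [hα, false_and, ne_eq, not_false_eq_true, true_and, false_or, bot_le, le_top,
        and_self, implies_true, forall_const]
      refine forall_congr' fun c => forall_congr' fun hc => exists_congr fun n =>
        forall_congr' fun i => forall_congr' fun _ => exists_congr fun β => ?_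
      rw [exists_prop]
      refine and_congr_right fun hβ => ?_
      rw [ih β hβ]
      have hle : c (i + 1) ≤ c i := hc (Nat.le_succ i)
      set A := c i
      set B := c (i + 1)
      let π := (B.submoduleOf A).mkQ
      have hk : LinearMap.ker π = B.submoduleOf A := Submodule.ker_mkQ _
      constructor
      · intro h
        refine DevLE.of_strictMonoOn (f := fun Y => (Y.comap A.subtype).map π) ?_
          (h.sub bot_le le_top)
        intro Y hY Z hZ hYZ
        refine lt_of_le_of_ne (Submodule.map_mono (Submodule.comap_mono hYZ.le)) fun he => hYZ.ne ?_
        have key : ∀ W ∈ Set.Icc B A, (((W.comap A.subtype).map π).comap π).map A.subtype = W := by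
          intro W hW
          rw [Submodule.comap_map_eq, hk, sup_eq_left.2 (Submodule.comap_mono hW.1),
            Submodule.map_comap_subtype, inf_eq_right.2 hW.2]
        have he' : (Y.comap A.subtype).map π = (Z.comap A.subtype).map π := he
        rw [← key Y hY, ← key Z hZ, he']
      · intro h
        refine DevLE.of_strictMonoOn (f := fun Y => (Y.comap π).map A.subtype)
          (StrictMono.strictMonoOn ?_ _) ?_
        · exact (Submodule.map_strictMono_of_injective A.injective_subtype).comp
            (Submodule.comap_strictMono_of_surjective (Submodule.mkQ_surjective _))
        · refine h.sub ?_ ?_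
          · rw [Submodule.comap_bot, hk, Submodule.submoduleOf, Submodule.map_comap_subtype,
              inf_eq_right.2 hle]
          · simp

end Krull

/-! ### Passing from cyclic submodules to whole factors -/

section Local

variable {S : Type*} [Ring S] {M : Type*} [AddCommGroup M] [Module S M]

theorem DevLE.sup_right {α : WithBot Ordinal.{v}} {a c F : Submodule S M} (h : DevLE α a c)
    (hac : a ≤ c) (hF : a ≤ F) : DevLE α F (F ⊔ c) := by
  rw [sup_comm]
  exact (h.sub (le_inf hac hF) le_rfl).sup_of_inf

/-- The factor `b / a` is locally of deviation at most `α`. -/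
def LocDevLE (α : WithBot Ordinal.{v}) (a b : Submodule S M) : Prop :=
  ∀ x ∈ b, DevLE α a (a ⊔ Submodule.span S {x})

/-- Here α is the successor of β. A counterexample [a, b] splits at some N into two counterexamples,
which contradicts `not_of_forall_split`. Given a chain X with infinitely many bad factors, N is
generated over a by elements chosen to keep infinitely many factors bad both in X ⊓ N and in X ⊔ N.
-/
theorem devLE_of_locDevLE_succ {α β : WithBot Ordinal.{v}} (hβα : β < α) (hα : ∀ γ < α, γ ≤ β)
    (hβ : ∀ {a b : Submodule S M}, a ≤ b → (∃ γ : WithBot Ordinal.{v}, DevLE γ a b) →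
      LocDevLE β a b → DevLE β a b)
    {a b : Submodule S M} (hab : a ≤ b) (hdev : ∃ γ : WithBot Ordinal.{v}, DevLE γ a b)
    (hloc : LocDevLE α a b) : DevLE α a b := by
  have hα0 : α ≠ ⊥ := (bot_le.trans_lt hβα).ne'
  have hlt : ∀ {c d : Submodule S M}, DevLT α c d ↔ DevLE β c d := fun {c d} =>
    ⟨fun ⟨γ, hγ, hd⟩ => hd.mono (hα γ hγ), fun h => ⟨β, hβα, h⟩⟩
  by_contra hnot
  obtain ⟨γ₀, hγ₀⟩ := hdev
  refine not_of_forall_split (p := fun a b : Submodule S M => a ≤ b ∧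
    (∃ γ : WithBot Ordinal.{v}, DevLE γ a b) ∧ LocDevLE α a b ∧ ¬ DevLE α a b) ?_ ?_ hγ₀
    ⟨hab, ⟨γ₀, hγ₀⟩, hloc, hnot⟩
  · rintro a b ⟨hab, -, -, hnot⟩
    by_contra h
    exact hnot (devLE_of_not_lt α h)
  clear! a b
  rintro a b ⟨hab, ⟨γ, hγ⟩, hloc, hnot⟩
  have hnot' := hnot
  rw [devLE_iff hα0] at hnot'
  push Not at hnot'
  obtain ⟨X, hX, hXab, hbad⟩ := hnot'
  simp only [hlt] at hbad
  -- As F / a is small, the traces X i ⊓ F are eventually good, so the badness survives modulo F.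
  have h1 : ∀ F : Submodule S M, a ≤ F → DevLE α a F → ∀ n, ∃ j ≥ n,
      ¬ DevLE β (X (j + 1) ⊔ F) (X j ⊔ F) := by
    intro F haF hF n
    obtain ⟨n₁, hn₁⟩ := (devLE_iff hα0).1 hF (fun i => X i ⊓ F)
      (fun i j hij => inf_le_inf_right _ (hX hij)) fun i => ⟨le_inf (hXab i).1 haF, inf_le_right⟩
    obtain ⟨j, hj, hjbad⟩ := hbad (max n n₁)
    refine ⟨j, le_of_max_le_left hj, fun h => hjbad ?_⟩
    exact DevLE.of_strictMonoOn (f := fun x => (x ⊓ F, x ⊔ F))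
      ((strictMono_inf_prod_sup (z := F)).strictMonoOn _)
      ((hlt.1 (hn₁ j (le_of_max_le_right hj))).prod h)
  have h2 : ∀ i, ¬ DevLE β (X (i + 1)) (X i) →
      ∃ x ∈ X i, ¬ DevLE β (X (i + 1)) (X (i + 1) ⊔ Submodule.span S {x}) := by
    intro i hi
    by_contra! hcon
    exact hi (hβ (hX (Nat.le_succ i)) ⟨γ, hγ.sub (hXab _).1 (hXab _).2⟩ hcon)
  choose I hI hIbad using hbad
  choose y hy hybad using h2
  choose J hJ hJbad using h1
  let St := {F : Submodule S M // a ≤ F ∧ F ≤ b ∧ DevLE α a F}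
  let jj : St × ℕ → ℕ := fun q => J q.1.1 q.1.2.1 q.1.2.2.2 q.2
  let ii : St × ℕ → ℕ := fun q => I (jj q + 1)
  let xx : St × ℕ → M := fun q => y (ii q) (hIbad _)
  have hxb : ∀ q, xx q ∈ b := fun q => (hXab _).2 (hy _ (hIbad _))
  have hstep : ∀ q : St × ℕ, a ≤ q.1.1 ⊔ Submodule.span S {xx q} ∧
      q.1.1 ⊔ Submodule.span S {xx q} ≤ b ∧ DevLE α a (q.1.1 ⊔ Submodule.span S {xx q}) := by
    intro q
    refine ⟨q.1.2.1.trans le_sup_left, sup_le q.1.2.2.1 ?_, ?_⟩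
    · rw [Submodule.span_singleton_le_iff_mem]; exact hxb q
    · refine q.1.2.2.2.trans q.1.2.1 le_sup_left ?_
      exact ((hloc _ (hxb q)).sup_right le_sup_left q.1.2.1).sub le_rfl
        (sup_le_sup_left le_sup_right _)
  -- Each round reserves an index j whose factor is bad modulo F, then adjoins to F an element
  -- witnessing a bad factor at a later index i > j. The next round starts beyond i.
  let s : ℕ → St × ℕ := fun n => Nat.rec (⟨a, le_rfl, hab, devLE_refl α a⟩, 0)
    (fun _ q => (⟨q.1.1 ⊔ Submodule.span S {xx q}, hstep q⟩, ii q + 1)) n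
  have hsF : ∀ n, (s (n + 1)).1.1 = (s n).1.1 ⊔ Submodule.span S {xx (s n)} := fun n => rfl
  have hsm : ∀ n, (s (n + 1)).2 = ii (s n) + 1 := fun n => rfl
  have hjm : ∀ n, (s n).2 ≤ jj (s n) := fun n => hJ _ _ _ _
  have hij : ∀ n, jj (s n) + 1 ≤ ii (s n) := fun n => hI _
  have hjmono : StrictMono fun n => jj (s n) := strictMono_nat_of_lt_succ fun n => by
    have := hjm (n + 1)
    rw [hsm] at this
    have := hij n
    omega
  let N : Submodule S M := ⨆ n, (s n).1.1
  have hFN : ∀ n, (s n).1.1 ≤ N := fun n => le_iSup (fun n => (s n).1.1) n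
  have hFmono : Monotone fun n => (s n).1.1 := monotone_nat_of_le_succ fun n => by
    rw [hsF]; exact le_sup_left
  have haN : a ≤ N := (s 0).1.2.1.trans (hFN 0)
  have hNb : N ≤ b := iSup_le fun n => (s n).1.2.2.1
  have hxX : ∀ n, xx (s n) ∈ X (ii (s n)) := fun n => hy _ _
  have hxN : ∀ n, xx (s n) ∈ N := fun n => by
    refine hFN (n + 1) ?_
    rw [hsF]
    exact Submodule.mem_sup_right (Submodule.mem_span_singleton_self _)
  -- All elements adjoined from round n on lie in X (j + 1), so modulo X (j + 1) the module N is no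
  -- larger than F, and the reserved factor stays bad.
  have hA : ∀ n, N ≤ (s n).1.1 ⊔ X (jj (s n) + 1) := by
    intro n
    have : ∀ k, (s (n + k)).1.1 ≤ (s n).1.1 ⊔ X (jj (s n) + 1) := by
      intro k
      induction k with
      | zero => exact le_sup_left
      | succ k ih =>
        rw [← add_assoc, hsF]
        refine sup_le ih (le_sup_of_le_right ?_)
        rw [Submodule.span_singleton_le_iff_mem]
        refine hX ?_ (hxX (n + k))
        have h3 := hjmono.monotone (Nat.le_add_right n k)
        have h4 := hij (n + k)
        change jj (s n) ≤ jj (s (n + k)) at h3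
        omega
    refine iSup_le fun m => ?_
    exact (hFmono (Nat.le_add_left m n)).trans (this m)
  have hB : ¬ DevLE α a N := by
    intro h
    obtain ⟨n, hn⟩ := (devLE_iff hα0).1 h (fun i => X i ⊓ N)
      (fun i j hij => inf_le_inf_right _ (hX hij)) fun i => ⟨le_inf (hXab i).1 haN, inf_le_right⟩
    have hni : n ≤ ii (s n) := by
      have h3 : n ≤ jj (s n) := hjmono.le_apply
      have := hij n
      omega
    have hd := hlt.1 (hn _ hni)
    refine hybad (ii (s n)) (hIbad _) ?_
    have hle : X (ii (s n) + 1) ≤ X (ii (s n)) := hX (Nat.le_succ _)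
    have hd' : DevLE β ((X (ii (s n)) ⊓ N) ⊓ X (ii (s n) + 1)) (X (ii (s n)) ⊓ N) :=
      hd.sub (by rw [inf_right_comm, inf_eq_right.2 hle]) le_rfl
    refine hd'.sup_of_inf.sub le_rfl (sup_le le_sup_right (le_sup_of_le_left ?_))
    rw [Submodule.span_singleton_le_iff_mem]
    exact ⟨hxX n, hxN n⟩
  have hC : ¬ DevLE α N b := by
    intro h
    obtain ⟨n, hn⟩ := (devLE_iff hα0).1 h (fun i => X i ⊔ N)
      (fun i j hij => sup_le_sup_right (hX hij) _) fun i => ⟨le_sup_right, sup_le (hXab i).2 hNb⟩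
    have hd := hlt.1 (hn _ (hjmono.le_apply (x := n)))
    refine hJbad (s n).1.1 (s n).1.2.1 (s n).1.2.2.2 (s n).2 (hd.sub ?_ ?_)
    · refine sup_le le_sup_left ((hA n).trans (sup_le le_sup_right le_sup_left))
    · exact sup_le_sup_left (hFN n) _
  refine ⟨N, ⟨haN, ⟨γ, hγ.sub le_rfl hNb⟩, fun x hx => hloc x (hNb hx), hB⟩,
    ⟨hNb, ⟨γ, hγ.sub haN le_rfl⟩, fun x hx => ?_, hC⟩⟩
  exact ((hloc x hx).sup_right le_sup_left haN).sub le_rfl (sup_le_sup_left le_sup_right _)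

theorem devLE_bot_of_locDevLE {a b : Submodule S M}
    (hloc : LocDevLE (⊥ : WithBot Ordinal.{v}) a b) : DevLE (⊥ : WithBot Ordinal.{v}) a b := by
  rw [devLE_bot]
  intro hlt
  obtain ⟨x, hxb, hxa⟩ := SetLike.exists_of_lt hlt
  refine devLE_bot.1 (hloc x hxb) (lt_of_le_of_ne le_sup_left fun he => hxa ?_)
  rw [he]
  exact Submodule.mem_sup_right (Submodule.mem_span_singleton_self _)

theorem devLE_zero_of_locDevLE {a b : Submodule S M} (hab : a ≤ b)
    (hdev : ∃ γ : WithBot Ordinal.{v}, DevLE γ a b)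
    (hloc : LocDevLE (0 : WithBot Ordinal.{v}) a b) : DevLE (0 : WithBot Ordinal.{v}) a b := by
  refine devLE_of_locDevLE_succ (β := ⊥) (WithBot.bot_lt_coe 0) (fun γ hγ => ?_)
    (fun _ _ h => devLE_bot_of_locDevLE h) hab hdev hloc
  induction γ with
  | bot => exact le_rfl
  | coe γ => exact absurd hγ (not_lt.2 (WithBot.coe_le_coe.2 zero_le))

theorem devLE_one_of_locDevLE {a b : Submodule S M} (hab : a ≤ b)
    (hdev : ∃ γ : WithBot Ordinal.{v}, DevLE γ a b)
    (hloc : LocDevLE (1 : WithBot Ordinal.{v}) a b) : DevLE (1 : WithBot Ordinal.{v}) a b := by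
  refine devLE_of_locDevLE_succ (β := 0) (WithBot.coe_lt_coe.2 zero_lt_one) (fun γ hγ => ?_)
    (fun h h' h'' => devLE_zero_of_locDevLE h h' h'') hab hdev hloc
  induction γ with
  | bot => exact bot_le
  | coe γ =>
    have : γ < 1 := WithBot.coe_lt_coe.1 hγ
    exact WithBot.coe_le_coe.2 (Order.lt_one_iff.1 this).le

end Local

/-! ### Elements annihilated by prime ideals -/

section Annihilator

open MulOpposite

/-- Map H to a product of copies of C. Criticality makes the image so large that it meets every
coordinate copy of C, so some h is nonzero under φ j alone. Intersections of kernels then embed the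
power set of ℕ. -/
theorem not_devLE_of_isCriticalAbove {S : Type*} [Ring S] {H M : Type*} [AddCommGroup H]
    [Module S H] [AddCommGroup M] [Module S M] {γ : WithBot Ordinal.{v}} {C : Submodule S M}
    (hC : IsCriticalAbove γ ⊥ C) {A : ℕ → Submodule S H} (hA : Monotone A)
    {φ : ℕ → H →ₗ[S] M} (hφC : ∀ i h, φ i h ∈ C) (hφ : ∀ i, ∀ h ∈ A i, φ i h = 0)
    (hφ' : ∀ i, ∃ h ∈ A (i + 1), φ i h ≠ 0) (α : WithBot Ordinal.{v}) :
    ¬ DevLE α (⊥ : Submodule S H) ⊤ := by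
  intro hH
  let Φ : H →ₗ[S] ℕ → M := LinearMap.pi φ
  let Y : Submodule S (ℕ → M) := (⨆ n, A n).map Φ
  let E : ℕ → Submodule S (ℕ → M) := fun n =>
    { carrier := {v | ∀ i, v i ∈ C ∧ (n ≤ i → v i = 0)}
      zero_mem' := fun i => ⟨C.zero_mem, fun _ => rfl⟩
      add_mem' := fun {v w} hv hw i => ⟨C.add_mem (hv i).1 (hw i).1, fun hi => by
        simp [(hv i).2 hi, (hw i).2 hi]⟩
      smul_mem' := fun r v hv i => ⟨C.smul_mem r (hv i).1, fun hi => by simp [(hv i).2 hi]⟩ }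
  have hE : ∀ n v, v ∈ E n ↔ ∀ i, v i ∈ C ∧ (n ≤ i → v i = 0) := fun n v => Iff.rfl
  have hEmono : ∀ n, E n ≤ E (n + 1) := fun n v hv i => ⟨(hv i).1, fun hi => (hv i).2 (by omega)⟩
  -- E n is a product of n copies of C. An element of A (n + 1) has image in E (n + 1) with nonzero
  -- last coordinate, so each new coordinate contributes only a proper quotient of C.
  have hsmall : ∀ n, DevLT γ (Y ⊓ E n) (E n) := by
    intro n
    induction n with
    | zero =>
      obtain ⟨β, hβ, -⟩ := (hC.2 C hC.1 le_rfl).2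
      have h0 : E 0 = ⊥ := by
        rw [eq_bot_iff]
        intro v hv
        rw [Submodule.mem_bot]
        exact funext fun i => (hv i).2 (Nat.zero_le i)
      rw [h0, inf_bot_eq]
      exact ⟨β, hβ, devLE_refl _ _⟩
    | succ n ih =>
      obtain ⟨β, hβ, hd⟩ := ih
      have h1 : DevLE β (Y ⊓ E (n + 1)) (E n ⊔ (Y ⊓ E (n + 1))) := by
        apply DevLE.sup_of_inf
        rwa [inf_left_comm, inf_eq_left.2 (hEmono n)]
      have hZ : E n ⊔ (Y ⊓ E (n + 1)) ≤ E (n + 1) := sup_le (hEmono n) inf_le_right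
      refine DevLT.trans le_sup_right hZ ⟨β, hβ, h1⟩ ?_
      set Z := E n ⊔ (Y ⊓ E (n + 1)) with hZdef
      let π : (ℕ → M) →ₗ[S] M := LinearMap.proj n
      have hZC : Z.map π ≤ C := by
        rintro _ ⟨v, hv, rfl⟩
        exact (hZ hv n).1
      have hZ0 : ⊥ < Z.map π := by
        rw [bot_lt_iff_ne_bot, Submodule.ne_bot_iff]
        obtain ⟨h, hh, hne⟩ := hφ' n
        refine ⟨φ n h, ⟨Φ h, Submodule.mem_sup_right ⟨⟨h, Submodule.mem_iSup_of_mem _ hh, rfl⟩,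
          fun i => ⟨hφC i h, fun hi => hφ i h (hA hi hh)⟩⟩, rfl⟩, hne⟩
      obtain ⟨β', hβ', hd'⟩ := (hC.2 _ hZ0 hZC).2
      refine ⟨β', hβ', DevLE.of_strictMonoOn (f := fun W => W.map π) ?_ (hd'.sub le_rfl ?_)⟩
      · intro W hW W' hW' hlt
        refine lt_of_le_of_ne (Submodule.map_mono hlt.le) fun he => ?_
        obtain ⟨w, hw', hw⟩ := SetLike.exists_of_lt hlt
        have he' : W.map π = W'.map π := he
        have : π w ∈ W.map π := he' ▸ Submodule.mem_map_of_mem hw'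
        obtain ⟨v, hv, hvw⟩ := this
        have hvw' : v n = w n := hvw
        have hmem : w - v ∈ E n := by
          have h2 : w - v ∈ E (n + 1) := (E (n + 1)).sub_mem (hW'.2 hw') (hW.2 hv)
          refine fun i => ⟨(h2 i).1, fun hi => ?_⟩
          rcases hi.eq_or_lt with rfl | hi
          · simp [hvw']
          · exact (h2 i).2 hi
        have h3 : w - v ∈ W := hW.1 (Submodule.mem_sup_left hmem)
        exact hw (by simpa using W.add_mem h3 hv)
      · rintro _ ⟨v, hv, rfl⟩
        exact (hv n).1
  have hex : ∀ j, ∃ h, φ j h ≠ 0 ∧ ∀ i, i ≠ j → φ i h = 0 := by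
    intro j
    let σ : M →ₗ[S] ℕ → M := LinearMap.single S (fun _ => M) j
    have hσ : Function.Injective σ := fun x y hxy => by
      simpa [σ] using congrFun hxy j
    have hne : Y ⊓ C.map σ ≠ ⊥ := by
      intro hbot
      obtain ⟨β, hβ, hd⟩ := hsmall (j + 1)
      have hSE : C.map σ ≤ E (j + 1) := by
        rintro _ ⟨x, hx, rfl⟩ i
        rcases eq_or_ne i j with rfl | hij
        · refine ⟨?_, fun hi => by omega⟩
          simpa [σ] using hx
        · simp [σ, hij]
      refine (hC.2 C hC.1 le_rfl).1 ⟨β, hβ, DevLE.of_strictMonoOn (f := fun W => W.map σ)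
        ((Submodule.map_strictMono_of_injective hσ).strictMonoOn _) ?_⟩
      have h1 : DevLE β (C.map σ ⊓ (Y ⊓ E (j + 1))) (C.map σ) :=
        (hd.sub le_rfl (sup_le hSE inf_le_right)).inf_of_sup
      refine h1.sub ?_ le_rfl
      rw [Submodule.map_bot, ← hbot]
      exact le_inf (inf_le_right.trans inf_le_left) inf_le_left
    obtain ⟨y, ⟨⟨h, -, hhy⟩, ⟨x, -, hxy⟩⟩, hy0⟩ := Submodule.exists_mem_ne_zero_of_ne_bot hne
    have hval : ∀ i, φ i h = (Pi.single j x : ℕ → M) i := fun i => by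
      change Φ h i = σ x i
      rw [hhy, hxy]
    refine ⟨h, fun h0 => hy0 ?_, fun i hi => ?_⟩
    · rw [hval, Pi.single_eq_same] at h0
      rw [← hxy, h0, map_zero]
    · rw [hval, Pi.single_eq_of_ne hi]
  let f : Set ℕ → Submodule S H := fun B => ⨅ i ∈ Bᶜ, LinearMap.ker (φ i)
  have hf : ∀ B h, h ∈ f B ↔ ∀ i, i ∉ B → φ i h = 0 := fun B h => by simp [f]
  refine not_devLE_of_strictMono_set (f := f) (fun B B' hB => ?_) α (hH.sub bot_le le_top)
  have hle : f B ≤ f B' := fun h hh => by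
    rw [hf] at hh ⊢
    exact fun i hi => hh i fun hiB => hi (hB.le hiB)
  refine lt_of_le_of_ne hle fun he => ?_
  obtain ⟨j, hj', hj⟩ := Set.exists_of_ssubset hB
  obtain ⟨h, hne, h0⟩ := hex j
  have h1 : h ∈ f B' := (hf _ _).2 fun i hi => h0 i fun hij => hi (hij ▸ hj')
  rw [← he, hf] at h1
  exact hne (h1 j hj)

variable {R : Type*} [Ring R] {M : Type*} [AddCommGroup M] [Module Rᵐᵒᵖ M]

/-- The annihilator of a submodule of a right module, a two-sided ideal. -/
def rightAnnihilator (D : Submodule Rᵐᵒᵖ M) : TwoSidedIdeal R :=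
  TwoSidedIdeal.mk' {r | ∀ x ∈ D, op r • x = 0} (fun x _ => by simp)
    (fun {a b} ha hb x hx => by
      rw [op_add, add_smul, ha x hx, hb x hx, add_zero])
    (fun {a} ha x hx => by rw [op_neg, neg_smul, ha x hx, neg_zero])
    (fun {a b} hb x hx => by rw [op_mul, mul_smul, hb _ (D.smul_mem _ hx)])
    (fun {a b} ha x hx => by rw [op_mul, mul_smul, ha x hx, smul_zero])

theorem mem_rightAnnihilator {D : Submodule Rᵐᵒᵖ M} {r : R} :
    r ∈ rightAnnihilator D ↔ ∀ x ∈ D, op r • x = 0 :=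
  TwoSidedIdeal.mem_mk' _ _ _ _ _ _ _

/-- A two-sided ideal as a right ideal. -/
def TwoSidedIdeal.toRight (I : TwoSidedIdeal R) : Submodule Rᵐᵒᵖ R where
  carrier := {x | x ∈ I}
  zero_mem' := I.zero_mem
  add_mem' := I.add_mem
  smul_mem' := fun r x hx => I.mul_mem_right x r.unop hx

theorem TwoSidedIdeal.mem_toRight {I : TwoSidedIdeal R} {x : R} : x ∈ I.toRight ↔ x ∈ I := Iff.rfl

/-- The map `r ↦ x r` from `R` to a right `R`-module. -/
def rightOrbitMap (x : M) : R →ₗ[Rᵐᵒᵖ] M where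
  toFun r := op r • x
  map_add' a b := by rw [op_add, add_smul]
  map_smul' r a := by
    rw [RingHom.id_apply, ← mul_smul, ← op_unop r, op_smul_eq_mul, op_mul]

/-- Inside a critical submodule, annihilators of shrinking nonzero submodules cannot grow strictly
forever. An annihilator that no longer grows is prime. -/
theorem exists_isPrimeTwoSided_annihilates {α β : WithBot Ordinal.{v}}
    (hR : DevLE α (⊥ : Submodule Rᵐᵒᵖ R) ⊤) (hM : DevLE β (⊥ : Submodule Rᵐᵒᵖ M) ⊤)
    [Nontrivial M] :
    ∃ P : TwoSidedIdeal R, IsPrimeTwoSided P ∧ ∃ x : M, x ≠ 0 ∧ ∀ p ∈ P, op p • x = 0 := by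
  obtain ⟨γ, C, -, hC⟩ := exists_isCriticalAbove hM bot_lt_top
  have hmax : ∃ D : Submodule Rᵐᵒᵖ M, ⊥ < D ∧
      ∀ D', ⊥ < D' → D' ≤ D → rightAnnihilator D' ≤ rightAnnihilator D := by
    by_contra! hcon
    choose g hg1 hg2 hg3 using hcon
    let s : ℕ → {D : Submodule Rᵐᵒᵖ M // ⊥ < D} := fun n =>
      Nat.rec ⟨C, hC.1⟩ (fun _ D => ⟨g D.1 D.2, hg1 D.1 D.2⟩) n
    have hanti : Antitone fun n => (s n).1 := antitone_nat_of_succ_le fun n => hg2 _ (s n).2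
    have hs : ∀ n, ∃ a, a ∈ rightAnnihilator (s (n + 1)).1 ∧ ∃ x ∈ (s n).1, op a • x ≠ 0 := by
      intro n
      obtain ⟨a, ha, ha'⟩ := SetLike.not_le_iff_exists.1 (hg3 _ (s n).2)
      rw [mem_rightAnnihilator] at ha'
      push Not at ha'
      exact ⟨a, ha, ha'⟩
    choose a ha x hx hne using hs
    refine not_devLE_of_isCriticalAbove hC (A := fun n => (rightAnnihilator (s n).1).toRight)
      (φ := fun n => rightOrbitMap (x n)) (fun m n hmn r hr => ?_) (fun i h => ?_)
      (fun i h hh => ?_) (fun i => ⟨a i, ha i, hne i⟩) α hR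
    · rw [TwoSidedIdeal.mem_toRight, mem_rightAnnihilator] at hr ⊢
      exact fun y hy => hr y (hanti hmn hy)
    · exact C.smul_mem _ (hanti (Nat.zero_le i) (hx i))
    · exact mem_rightAnnihilator.1 hh _ (hx i)
  obtain ⟨D, hD, hDmax⟩ := hmax
  obtain ⟨x, hxD, hx0⟩ := Submodule.exists_mem_ne_zero_of_ne_bot hD.ne'
  refine ⟨rightAnnihilator D, ⟨fun htop => hx0 ?_, fun I J hIJ => ?_⟩, x, hx0,
    fun p hp => mem_rightAnnihilator.1 hp x hxD⟩
  · have : (1 : R) ∈ rightAnnihilator D := by rw [htop]; trivial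
    simpa using mem_rightAnnihilator.1 this x hxD
  · by_contra! hcon
    obtain ⟨hI, hJ⟩ := hcon
    obtain ⟨a, haI, ha⟩ := SetLike.not_le_iff_exists.1 hI
    rw [mem_rightAnnihilator] at ha
    push Not at ha
    obtain ⟨y, hyD, hy⟩ := ha
    let D' : Submodule Rᵐᵒᵖ M := Submodule.span Rᵐᵒᵖ {z | ∃ b ∈ I, ∃ w ∈ D, op b • w = z}
    have hD'D : D' ≤ D := by
      refine Submodule.span_le.2 ?_
      rintro _ ⟨b, -, w, hw, rfl⟩
      exact D.smul_mem _ hw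
    have hD'0 : ⊥ < D' := by
      rw [bot_lt_iff_ne_bot, Submodule.ne_bot_iff]
      exact ⟨_, Submodule.subset_span ⟨a, haI, y, hyD, rfl⟩, hy⟩
    refine hJ (le_trans ?_ (hDmax D' hD'0 hD'D))
    intro j hj
    rw [mem_rightAnnihilator]
    intro z hz
    induction hz using Submodule.span_induction generalizing j with
    | mem z hz =>
      obtain ⟨b, hb, w, hw, rfl⟩ := hz
      rw [← mul_smul, ← op_mul]
      exact mem_rightAnnihilator.1 (hIJ b hb j hj) w hw
    | zero => exact smul_zero _
    | add z w _ _ hz hw => rw [smul_add, hz hj, hw hj, add_zero]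
    | smul r z _ hz =>
      rw [← mul_smul, ← op_unop r, ← op_mul]
      exact hz (J.mul_mem_left _ _ hj)

end Annihilator

/-! ### Goldie theory and the semiprime case -/

section RightIdeals

open MulOpposite

variable {R : Type*} [Ring R]

theorem Submodule.mul_mem_of_mem_left {I : Submodule Rᵐᵒᵖ R} {x : R} (hx : x ∈ I) (r : R) :
    x * r ∈ I :=
  I.smul_mem (op r) hx

theorem mem_span_op_singleton {x y : R} :
    y ∈ Submodule.span Rᵐᵒᵖ {x} ↔ ∃ r, x * r = y := by
  rw [Submodule.mem_span_singleton]
  exact ⟨fun ⟨r, hr⟩ => ⟨r.unop, hr⟩, fun ⟨r, hr⟩ => ⟨op r, hr⟩⟩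

theorem rightOrbitMap_self_apply (x r : R) : rightOrbitMap (R := R) (M := R) x r = x * r := rfl

/-- The factor is a quotient of R/I. -/
theorem devLE_sup_span {M : Type*} [AddCommGroup M] [Module Rᵐᵒᵖ M] {α : WithBot Ordinal.{v}}
    {B : Submodule Rᵐᵒᵖ M} {x : M} {I : Submodule Rᵐᵒᵖ R} (hI : DevLE α I ⊤)
    (hx : ∀ r ∈ I, op r • x ∈ B) : DevLE α B (B ⊔ Submodule.span Rᵐᵒᵖ {x}) := by
  have hmem : ∀ r : R, op r • x ∈ Submodule.span Rᵐᵒᵖ {x} := fun r =>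
    Submodule.smul_mem _ _ (Submodule.mem_span_singleton_self x)
  refine DevLE.of_strictMonoOn (f := fun W => W.comap (rightOrbitMap x)) ?_ (hI.sub hx le_top)
  intro W hW W' hW' hlt
  refine lt_of_le_of_ne (Submodule.comap_mono hlt.le) fun he => ?_
  obtain ⟨w, hw', hw⟩ := SetLike.exists_of_lt hlt
  obtain ⟨b, hb, z, hz, rfl⟩ := Submodule.mem_sup.1 (hW'.2 hw')
  obtain ⟨r, rfl⟩ := Submodule.mem_span_singleton.1 hz
  have he' : W.comap (rightOrbitMap x) = W'.comap (rightOrbitMap x) := he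
  have h1 : r.unop ∈ W'.comap (rightOrbitMap x) := by
    have := W'.sub_mem hw' (hW'.1 hb)
    rwa [add_sub_cancel_left] at this
  rw [← he'] at h1
  exact hw (W.add_mem (hW.1 hb) h1)

/-- A right ideal that meets every nonzero right ideal. -/
def IsEssentialRight (E : Submodule Rᵐᵒᵖ R) : Prop :=
  ∀ D : Submodule Rᵐᵒᵖ R, D ⊓ E = ⊥ → D = ⊥

theorem isEssentialRight_of_forall {E : Submodule Rᵐᵒᵖ R}
    (h : ∀ y : R, y ≠ 0 → ∃ r, y * r ∈ E ∧ y * r ≠ 0) : IsEssentialRight E := by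
  intro D hD
  by_contra hne
  obtain ⟨y, hyD, hy⟩ := Submodule.exists_mem_ne_zero_of_ne_bot hne
  obtain ⟨r, hr, hr0⟩ := h y hy
  have : y * r ∈ D ⊓ E := ⟨Submodule.mul_mem_of_mem_left hyD r, hr⟩
  rw [hD] at this
  exact hr0 this

theorem isEssentialRight_of_forall_mem {F E : Submodule Rᵐᵒᵖ R} (x : R)
    (hE : ∀ D ≤ F, D ⊓ E = ⊥ → D = ⊥) (hx : x ∈ F) :
    IsEssentialRight (E.comap (rightOrbitMap x)) := by
  refine isEssentialRight_of_forall fun y hy => ?_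
  by_cases hxy : x * y = 0
  · refine ⟨1, ?_, by simpa using hy⟩
    change x * (y * 1) ∈ E
    rw [mul_one, hxy]
    exact E.zero_mem
  · by_contra! hcon
    refine hxy (Submodule.span_singleton_eq_bot.1 (hE (Submodule.span Rᵐᵒᵖ {x * y}) ?_ ?_))
    · rw [Submodule.span_singleton_le_iff_mem]
      exact Submodule.mul_mem_of_mem_left hx y
    · rw [eq_bot_iff]
      rintro z ⟨hz, hzE⟩
      obtain ⟨r, rfl⟩ := mem_span_op_singleton.1 hz
      rw [mul_assoc] at hzE ⊢
      rw [hcon r hzE, mul_zero]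
      exact Submodule.zero_mem _

theorem IsEssentialRight.comap_mul {E : Submodule Rᵐᵒᵖ R} (hE : IsEssentialRight E) (x : R) :
    IsEssentialRight (E.comap (rightOrbitMap x)) :=
  isEssentialRight_of_forall_mem (F := ⊤) x (fun D _ => hE D) trivial

variable {α : WithBot Ordinal.{v}}

/-- If D ∩ cR = 0, then D, cD, c²D, … are independent. -/
theorem isEssentialRight_span_of_rightInjective (hR : DevLE α (⊥ : Submodule Rᵐᵒᵖ R) ⊤) {c : R}
    (hc : ∀ x, c * x = 0 → x = 0) : IsEssentialRight (Submodule.span Rᵐᵒᵖ {c}) := by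
  intro D hD
  by_contra hne
  have hpow : ∀ n x, c ^ n * x = 0 → x = 0 := by
    intro n
    induction n with
    | zero => simp
    | succ n ih => exact fun x hx => hc x (ih _ (by rwa [pow_succ, mul_assoc] at hx))
  refine not_devLE_of_antitone (X := fun n => Submodule.span Rᵐᵒᵖ {c ^ n})
    (D := fun n => D.map (rightOrbitMap (c ^ n))) (antitone_nat_of_succ_le fun n => ?_)
    (fun n => ?_) (fun n h => hne ?_) (fun n => ?_) α hR
  · rw [Submodule.span_singleton_le_iff_mem, mem_span_op_singleton]
    exact ⟨c, (pow_succ c n).symm⟩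
  · rintro _ ⟨d, -, rfl⟩
    exact mem_span_op_singleton.2 ⟨d, rfl⟩
  · rw [eq_bot_iff] at h ⊢
    exact fun d hd => hpow n d (h ⟨d, hd, rfl⟩)
  · rw [eq_bot_iff]
    rintro _ ⟨⟨d, hd, rfl⟩, h⟩
    obtain ⟨r, hr⟩ := mem_span_op_singleton.1 h
    rw [rightOrbitMap_self_apply] at hr ⊢
    have h1 : d = c * r := by
      have : c ^ n * (d - c * r) = 0 := by
        rw [mul_sub, ← hr, pow_succ, mul_assoc, sub_self]
      exact sub_eq_zero.1 (hpow n _ this)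
    have h2 : d ∈ D ⊓ Submodule.span Rᵐᵒᵖ {c} :=
      ⟨hd, mem_span_op_singleton.2 ⟨r, h1.symm⟩⟩
    rw [hD] at h2
    rw [(Submodule.mem_bot _).1 h2, mul_zero]
    exact Submodule.zero_mem _

/-- Semiprimeness gives a nonzero map C → C, left multiplication by u, on a critical C. A nonzero
kernel would make its image a nonzero submodule of C of too small deviation. -/
theorem exists_mul_injOn_of_ne_bot (hsp : ∀ x : R, (∀ r, x * r * x = 0) → x = 0)
    (hR : DevLE α (⊥ : Submodule Rᵐᵒᵖ R) ⊤)
    {I : Submodule Rᵐᵒᵖ R} (hI : I ≠ ⊥) :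
    ∃ C ≤ I, C ≠ ⊥ ∧ ∃ u ∈ C, ∀ x ∈ C, u * x = 0 → x = 0 := by
  obtain ⟨γ, C, hCI, hC0, hC⟩ :=
    exists_isCriticalAbove (hR.sub le_rfl le_top) (bot_lt_iff_ne_bot.2 hI)
  refine ⟨C, hCI, hC0.ne', ?_⟩
  obtain ⟨x, hxC, hx0⟩ := Submodule.exists_mem_ne_zero_of_ne_bot hC0.ne'
  obtain ⟨r, hr⟩ := not_forall.1 fun h => hx0 (hsp x h)
  set u := x * r with hu
  have huC : u ∈ C := Submodule.mul_mem_of_mem_left hxC r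
  refine ⟨u, huC, ?_⟩
  by_contra! hcon
  obtain ⟨y, hyC, huy, hy0⟩ := hcon
  let φ : R →ₗ[Rᵐᵒᵖ] R := rightOrbitMap u
  have hφ : ∀ z, φ z = u * z := fun _ => rfl
  let K : Submodule Rᵐᵒᵖ R := LinearMap.ker φ ⊓ C
  have hK0 : ⊥ < K := by
    rw [bot_lt_iff_ne_bot, Submodule.ne_bot_iff]
    exact ⟨y, ⟨huy, hyC⟩, hy0⟩
  have hmap0 : ⊥ < C.map φ := by
    rw [bot_lt_iff_ne_bot, Submodule.ne_bot_iff]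
    exact ⟨u * x, ⟨x, hxC, rfl⟩, hr⟩
  have hmapC : C.map φ ≤ C := by
    rintro _ ⟨z, -, rfl⟩
    exact Submodule.mul_mem_of_mem_left huC z
  obtain ⟨β, hβ, hd⟩ := (hC K hK0 inf_le_right).2
  refine (hC _ hmap0 hmapC).1 ⟨β, hβ, DevLE.of_strictMonoOn (f := fun W => W.comap φ ⊓ C) ?_
    (hd.sub ?_ inf_le_right)⟩
  · intro W hW W' hW' hlt
    refine lt_of_le_of_ne (inf_le_inf_right _ (Submodule.comap_mono hlt.le)) fun he => ?_
    obtain ⟨w, hw', hw⟩ := SetLike.exists_of_lt hlt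
    obtain ⟨z, hzC, rfl⟩ := hW'.2 hw'
    have he' : W.comap φ ⊓ C = W'.comap φ ⊓ C := he
    have h1 : z ∈ W'.comap φ ⊓ C := ⟨hw', hzC⟩
    rw [← he'] at h1
    exact hw h1.1
  · rw [Submodule.comap_bot]

/-- R is right nonsingular: if u = xs is injective on C ≤ xR, then C meets the essential right ideal
{r | sr ∈ E}, on which u vanishes. -/
theorem eq_zero_of_mul_essential_eq_zero (hsp : ∀ x : R, (∀ r, x * r * x = 0) → x = 0)
    (hR : DevLE α (⊥ : Submodule Rᵐᵒᵖ R) ⊤)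
    {E : Submodule Rᵐᵒᵖ R} (hE : IsEssentialRight E) {x : R} (hx : ∀ e ∈ E, x * e = 0) :
    x = 0 := by
  by_contra hne
  obtain ⟨C, hCI, hC0, u, huC, hu⟩ := exists_mul_injOn_of_ne_bot hsp hR
    (I := Submodule.span Rᵐᵒᵖ {x}) (by rwa [Ne, Submodule.span_singleton_eq_bot])
  obtain ⟨s, rfl⟩ := mem_span_op_singleton.1 (hCI huC)
  refine hC0 (hE.comap_mul s C ?_)
  rw [eq_bot_iff]
  rintro z ⟨hzC, hz⟩
  refine hu z hzC ?_
  rw [mul_assoc]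
  exact hx _ hz

theorem isRegular_of_rightInjective (hsp : ∀ x : R, (∀ r, x * r * x = 0) → x = 0)
    (hR : DevLE α (⊥ : Submodule Rᵐᵒᵖ R) ⊤) {c : R}
    (hc : ∀ x, c * x = 0 → x = 0) : IsRegular c := by
  refine ⟨isLeftRegular_of_non_zero_divisor c hc, isRightRegular_of_non_zero_divisor c ?_⟩
  intro x hx
  refine eq_zero_of_mul_essential_eq_zero hsp hR
    (isEssentialRight_span_of_rightInjective hR hc) fun e he => ?_
  obtain ⟨r, rfl⟩ := mem_span_op_singleton.1 he
  rw [← mul_assoc, hx, zero_mul]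

theorem IsEssentialRight.exists_isRegular_mem (hsp : ∀ x : R, (∀ r, x * r * x = 0) → x = 0)
    (hR : DevLE α (⊥ : Submodule Rᵐᵒᵖ R) ⊤)
    {E : Submodule Rᵐᵒᵖ R} (hE : IsEssentialRight E) : ∃ c ∈ E, IsRegular c := by
  by_contra! hcon
  -- The condition says cR ∩ ann(c) = 0. It makes ann(c + u) = ann(c) ∩ ann(u) when u is chosen in
  -- ann(c) ∩ E, so annihilators drop by an independent piece at each step until c is regular.
  let St := {c : R // c ∈ E ∧ ∀ y, c * (c * y) = 0 → c * y = 0}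
  have hstep : ∀ c : St, ∃ C : Submodule Rᵐᵒᵖ R, C ≠ ⊥ ∧ (∀ x ∈ C, c.1 * x = 0) ∧
      ∃ c' : St, (∀ x, c'.1 * x = 0 → c.1 * x = 0) ∧ ∀ x ∈ C, c'.1 * x = 0 → x = 0 := by
    rintro ⟨c, hcE, hc⟩
    have hI : LinearMap.ker (rightOrbitMap (R := R) (M := R) c) ⊓ E ≠ ⊥ := by
      intro hbot
      refine hcon c hcE (isRegular_of_rightInjective hsp hR fun x hx => ?_)
      have : x ∈ LinearMap.ker (rightOrbitMap (R := R) (M := R) c) := hx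
      rw [hE _ hbot] at this
      exact this
    obtain ⟨C, hCI, hC0, u, huC, hu⟩ := exists_mul_injOn_of_ne_bot hsp hR hI
    have hcC : ∀ x ∈ C, c * x = 0 := fun x hx => (hCI hx).1
    have key : ∀ x, (c + u) * x = 0 → c * x = 0 ∧ u * x = 0 := by
      intro x hx
      rw [add_mul] at hx
      have h1 : c * (u * x) = 0 := hcC _ (Submodule.mul_mem_of_mem_left huC x)
      have h2 : c * x = 0 := hc x (by
        rw [eq_neg_of_add_eq_zero_left hx, mul_neg, h1, neg_zero])
      rw [h2, zero_add] at hx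
      exact ⟨h2, hx⟩
    refine ⟨C, hC0, hcC, ⟨c + u, E.add_mem hcE (hCI huC).2, fun y hy => ?_⟩,
      fun x hx => (key x hx).1, fun x hxC hx => hu x hxC (key x hx).2⟩
    obtain ⟨h1, h2⟩ := key _ hy
    have huy : u * y ∈ C := Submodule.mul_mem_of_mem_left huC y
    rw [add_mul, mul_add, hcC _ huy, add_zero] at h1
    have h3 := hc y h1
    rw [add_mul, h3, zero_add] at h2
    rw [add_mul, h3, zero_add]
    exact hu _ huy h2
  choose D hD0 hD g hg1 hg2 using hstep
  let s : ℕ → St := fun n => Nat.rec ⟨0, E.zero_mem, by simp⟩ (fun _ c => g c) n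
  refine not_devLE_of_antitone (X := fun n => LinearMap.ker (rightOrbitMap (R := R) (M := R) (s n).1))
    (D := fun n => D (s n)) (antitone_nat_of_succ_le ?_) ?_ (fun n => hD0 _) ?_ α hR
  · exact fun n x hx => hg1 (s n) x hx
  · exact fun n x hx => hD (s n) x hx
  · intro n
    rw [eq_bot_iff]
    rintro x ⟨hxD, hx⟩
    exact hg2 (s n) x hxD hx

theorem devLE_zero_of_isEssentialRight (hsp : ∀ x : R, (∀ r, x * r * x = 0) → x = 0)
    (hR : DevLE α (⊥ : Submodule Rᵐᵒᵖ R) ⊤)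
    (hacc : LeftACCReg R) (hmax : MaximalRightIdealsPrincipal R) {E : Submodule Rᵐᵒᵖ R}
    (hE : IsEssentialRight E) : DevLE (0 : WithBot Ordinal.{v}) E ⊤ := by
  by_contra hnot
  obtain ⟨c, hcE, hc⟩ := hE.exists_isRegular_mem hsp hR
  let St := {d : R // IsRegular d ∧ ∃ E : Submodule Rᵐᵒᵖ R, IsEssentialRight E ∧ d ∈ E ∧
    ¬ DevLE (0 : WithBot Ordinal.{v}) E ⊤}
  have hstep : ∀ d : St, ∃ d' : St, ∃ a : R, d.1 = a * d'.1 ∧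
      Submodule.span Rᵐᵒᵖ {a} ≠ ⊤ ∧ ∀ x, x * a = 0 → x = 0 := by
    rintro ⟨d, hd, E, hE, hdE, hnot⟩
    have hE1 : (1 : R) ∉ E := fun h1 => hnot <| by
      rw [(eq_top_iff.2 fun x _ => by simpa using Submodule.mul_mem_of_mem_left h1 x : E = ⊤)]
      exact devLE_refl _ _
    obtain ⟨m, hm, hEm⟩ : ∃ m : Submodule Rᵐᵒᵖ R, IsCoatom m ∧ E ≤ m := by
      have : Module.Finite Rᵐᵒᵖ R := ⟨⟨{1}, eq_top_iff.2 fun x _ => by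
        rw [Finset.coe_singleton]
        exact mem_span_op_singleton.2 ⟨x, one_mul x⟩⟩⟩
      rcases eq_top_or_exists_le_coatom E with h | h
      · exact absurd (h ▸ Submodule.mem_top) hE1
      · exact h
    obtain ⟨a, rfl⟩ := hmax m hm
    obtain ⟨d', hd'⟩ := mem_span_op_singleton.1 (hEm hdE)
    have hd'0 : ∀ x, d' * x = 0 → x = 0 := fun x hx => by
      refine hd.left.mul_left_eq_zero_iff.1 ?_
      rw [← hd', mul_assoc, hx, mul_zero]
    have ha : ∀ x, a * x = 0 → x = 0 := by
      have hess := isEssentialRight_span_of_rightInjective hR hd'0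
      have : LinearMap.ker (rightOrbitMap (R := R) (M := R) a) = ⊥ := by
        refine hess _ ?_
        rw [eq_bot_iff]
        rintro x ⟨hx, hx'⟩
        obtain ⟨r, rfl⟩ := mem_span_op_singleton.1 hx'
        have h1 : a * (d' * r) = 0 := hx
        rw [← mul_assoc, hd'] at h1
        rw [hd.left.mul_left_eq_zero_iff.1 h1, mul_zero]
        exact Submodule.zero_mem _
      intro x hx
      have hx' : x ∈ LinearMap.ker (rightOrbitMap (R := R) (M := R) a) := hx
      rw [this] at hx'
      exact hx'
    refine ⟨⟨d', isRegular_of_rightInjective hsp hR hd'0, E.comap (rightOrbitMap a),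
      hE.comap_mul a, ?_, fun h => hnot ?_⟩, a, hd'.symm, hm.1, fun x hx => ?_⟩
    · change a * d' ∈ E
      rwa [hd']
    · refine DevLE.trans hEm le_top ?_ ?_
      · have := devLE_sup_span (B := E) (x := a) h fun r hr => hr
        exact this.sub le_rfl le_sup_right
      -- Since aR is maximal, a chain between aR and R is eventually constant.
      · rw [devLE_iff (by exact WithBot.coe_ne_bot)]
        intro X hX hXab
        by_cases htop : ∀ i, X i = ⊤
        · refine ⟨0, fun i _ => ⟨⊥, WithBot.bot_lt_coe 0, ?_⟩⟩
          rw [htop, htop]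
          exact devLE_refl _ _
        · obtain ⟨n, hn⟩ := not_forall.1 htop
          have hXn : ∀ i ≥ n, X i = Submodule.span Rᵐᵒᵖ {a} := fun i hi => by
            refine (hm.le_iff_eq ?_).1 (hXab i).1
            exact fun h => hn (top_le_iff.1 (h ▸ hX hi))
          refine ⟨n, fun i hi => ⟨⊥, WithBot.bot_lt_coe 0, ?_⟩⟩
          rw [hXn i hi, hXn (i + 1) (by omega)]
          exact devLE_refl _ _
    · exact (isRegular_of_rightInjective hsp hR ha).right.mul_right_eq_zero_iff.1 hx
  choose g a hga ha hreg using hstep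
  let s : ℕ → St := fun n => Nat.rec ⟨c, hc, E, hE, hcE, hnot⟩ (fun _ d => g d) n
  have hs : ∀ n, (s n).1 = a (s n) * (s (n + 1)).1 := fun n => hga (s n)
  obtain ⟨n, hn⟩ := hacc (fun n => (s n).1) (fun n => (s n).2.1)
    (monotone_nat_of_le_succ fun n => by
      rw [Ideal.span_le, Set.singleton_subset_iff, SetLike.mem_coe, Ideal.mem_span_singleton']
      exact ⟨_, (hs n).symm⟩)
  have h1 : (s (n + 1)).1 ∈ Ideal.span {(s n).1} := by
    rw [← hn (n + 1) (Nat.le_succ n)]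
    exact Ideal.subset_span rfl
  obtain ⟨t, ht⟩ := Ideal.mem_span_singleton'.1 h1
  -- Cancelling the regular element d' from t a d' = d' gives a left inverse of a. As a is right
  -- cancellable, it is two-sided, so aR = R.
  have h2 : t * a (s n) = 1 := by
    refine (s (n + 1)).2.1.right ?_
    simp only
    rw [mul_assoc, ← hs, ht, one_mul]
  refine ha (s n) (eq_top_iff.2 fun x _ => mem_span_op_singleton.2 ⟨t * x, ?_⟩)
  have h3 : (a (s n) * t - 1) * a (s n) = 0 := by
    rw [sub_mul, mul_assoc, h2, mul_one, one_mul, sub_self]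
  rw [← mul_assoc, sub_eq_zero.1 (hreg _ _ h3), one_mul]

theorem devLE_one_of_semiprime (hsp : ∀ x : R, (∀ r, x * r * x = 0) → x = 0)
    (hR : DevLE α (⊥ : Submodule Rᵐᵒᵖ R) ⊤)
    (hacc : LeftACCReg R) (hmax : MaximalRightIdealsPrincipal R) :
    DevLE (1 : WithBot Ordinal.{v}) (⊥ : Submodule Rᵐᵒᵖ R) ⊤ := by
  rw [devLE_iff (by exact WithBot.coe_ne_bot)]
  intro X hX _
  obtain ⟨n, hn⟩ := exists_forall_essential hR hX
  refine ⟨n, fun i hi => ⟨0, WithBot.coe_lt_coe.2 zero_lt_one, ?_⟩⟩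
  refine devLE_zero_of_locDevLE (hX (Nat.le_succ i)) ⟨α, hR.sub bot_le le_top⟩ fun x hx => ?_
  exact devLE_sup_span (devLE_zero_of_isEssentialRight hsp hR hacc hmax
    (isEssentialRight_of_forall_mem x (hn i hi) hx)) fun r hr => hr

end RightIdeals

/-! ### Passage to quotient rings -/

section Transfer

variable {R S : Type*} [Ring R] [Ring S]

/-- The preimage of a right ideal under a ring homomorphism. -/
def comapRight (f : R →+* S) (I : Submodule Sᵐᵒᵖ S) : Submodule Rᵐᵒᵖ R where
  carrier := {x | f x ∈ I}
  zero_mem' := by simp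
  add_mem' {a b} ha hb := by simpa using I.add_mem ha hb
  smul_mem' r x hx := by
    change f (x * r.unop) ∈ I
    rw [map_mul]
    exact Submodule.mul_mem_of_mem_left hx _

/-- The image of a right ideal under a surjective ring homomorphism. -/
def mapRight (f : R →+* S) (hf : Function.Surjective f) (I : Submodule Rᵐᵒᵖ R) :
    Submodule Sᵐᵒᵖ S where
  carrier := f '' I
  zero_mem' := ⟨0, I.zero_mem, map_zero f⟩
  add_mem' := by
    rintro _ _ ⟨a, ha, rfl⟩ ⟨b, hb, rfl⟩
    exact ⟨a + b, I.add_mem ha hb, map_add f a b⟩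
  smul_mem' := by
    rintro s _ ⟨a, ha, rfl⟩
    obtain ⟨r, hr⟩ := hf s.unop
    refine ⟨a * r, Submodule.mul_mem_of_mem_left ha r, ?_⟩
    rw [map_mul, hr]
    rfl

variable {f : R →+* S}

theorem mem_comapRight {I : Submodule Sᵐᵒᵖ S} {x : R} : x ∈ comapRight f I ↔ f x ∈ I := Iff.rfl

theorem mem_of_mem_mapRight (hf : Function.Surjective f) {I : Submodule Rᵐᵒᵖ R}
    (hI : comapRight f ⊥ ≤ I) {x : R} (hx : f x ∈ mapRight f hf I) : x ∈ I := by
  obtain ⟨y, hy, hyx⟩ := hx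
  have h : x - y ∈ I := hI (by
    change f (x - y) ∈ (⊥ : Submodule Sᵐᵒᵖ S)
    rw [map_sub, hyx, sub_self]
    exact Submodule.zero_mem _)
  simpa using I.add_mem h hy

theorem comapRight_strictMono (hf : Function.Surjective f) : StrictMono (comapRight f) := by
  intro I J hIJ
  obtain ⟨y, hyJ, hyI⟩ := SetLike.exists_of_lt hIJ
  obtain ⟨x, rfl⟩ := hf y
  exact lt_of_le_of_ne (fun x hx => hIJ.le hx) fun he => hyI (by
    have : x ∈ comapRight f J := hyJ
    rwa [← he] at this)

theorem DevLE.of_surjective (hf : Function.Surjective f) {α : WithBot Ordinal.{v}}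
    (h : DevLE α (⊥ : Submodule Rᵐᵒᵖ R) ⊤) : DevLE α (⊥ : Submodule Sᵐᵒᵖ S) ⊤ :=
  DevLE.of_strictMonoOn ((comapRight_strictMono hf).strictMonoOn _) (h.sub bot_le le_top)

theorem devLE_comapRight_bot (hf : Function.Surjective f) {α : WithBot Ordinal.{v}}
    (h : DevLE α (⊥ : Submodule Sᵐᵒᵖ S) ⊤) : DevLE α (comapRight f ⊥) ⊤ := by
  refine DevLE.of_strictMonoOn (f := mapRight f hf) ?_ (h.sub bot_le le_top)
  intro I hI J hJ hIJ
  obtain ⟨x, hxJ, hxI⟩ := SetLike.exists_of_lt hIJ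
  refine lt_of_le_of_ne (Set.image_mono hIJ.le) fun he =>
    hxI (mem_of_mem_mapRight hf hI.1 ?_)
  rw [he]
  exact ⟨x, hxJ, rfl⟩

theorem MaximalRightIdealsPrincipal.of_surjective (hf : Function.Surjective f)
    (h : MaximalRightIdealsPrincipal R) : MaximalRightIdealsPrincipal S := by
  intro m hm
  have hcoatom : IsCoatom (comapRight f m) := by
    refine ⟨fun htop => hm.1 ?_, fun I hI => ?_⟩
    · refine eq_top_iff.2 fun y _ => ?_
      obtain ⟨x, rfl⟩ := hf y
      have : x ∈ comapRight f m := htop ▸ Submodule.mem_top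
      exact this
    · have hker : comapRight f ⊥ ≤ I :=
        ((comapRight_strictMono hf).monotone bot_le).trans hI.le
      obtain ⟨x, hxI, hx⟩ := SetLike.exists_of_lt hI
      have hlt : m < mapRight f hf I := by
        refine lt_of_le_of_ne (fun y hy => ?_) fun he => hx ?_
        · obtain ⟨z, rfl⟩ := hf y
          exact ⟨z, hI.le hy, rfl⟩
        · rw [mem_comapRight, he]
          exact ⟨x, hxI, rfl⟩
      refine eq_top_iff.2 fun z _ => mem_of_mem_mapRight hf hker ?_
      rw [hm.2 _ hlt]
      exact Submodule.mem_top
  obtain ⟨a, ha⟩ := h _ hcoatom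
  refine ⟨f a, le_antisymm (fun y hy => ?_) ?_⟩
  · obtain ⟨x, rfl⟩ := hf y
    have hx : x ∈ comapRight f m := hy
    rw [ha] at hx
    obtain ⟨r, rfl⟩ := mem_span_op_singleton.1 hx
    exact mem_span_op_singleton.2 ⟨f r, (map_mul f a r).symm⟩
  · rw [Submodule.span_singleton_le_iff_mem, ← mem_comapRight, ha]
    exact Submodule.mem_span_singleton_self a

end Transfer

/-! ### Prime ideals and reduction to the semiprime case -/

section TwoSided

variable {R : Type*} [Ring R]

/-- A semiprime two-sided ideal, in terms of elements. -/
def IsSemiprimeTwoSided (Q : TwoSidedIdeal R) : Prop :=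
  ∀ x, (∀ r, x * r * x ∈ Q) → x ∈ Q

theorem IsPrimeTwoSided.isSemiprime {P : TwoSidedIdeal R} (hP : IsPrimeTwoSided P) :
    IsSemiprimeTwoSided P := by
  intro x hx
  -- I consists of the a with aRx ⊆ P, and J is the right annihilator of I modulo P. Both contain x.
  let I : TwoSidedIdeal R := TwoSidedIdeal.mk' {a | ∀ r, a * r * x ∈ P}
    (fun r => by simp [P.zero_mem])
    (fun {a b} ha hb r => by rw [add_mul, add_mul]; exact P.add_mem (ha r) (hb r))
    (fun {a} ha r => by rw [neg_mul, neg_mul]; exact P.neg_mem (ha r))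
    (fun {a b} hb r => by rw [mul_assoc a, mul_assoc a]; exact P.mul_mem_left _ _ (hb r))
    (fun {a b} ha r => by rw [mul_assoc a]; exact ha _)
  have hI : ∀ a, a ∈ I ↔ ∀ r, a * r * x ∈ P := fun a => TwoSidedIdeal.mem_mk' _ _ _ _ _ _ _
  let J : TwoSidedIdeal R := TwoSidedIdeal.mk' {b | ∀ a ∈ I, a * b ∈ P}
    (fun a _ => by simp [P.zero_mem])
    (fun {b c} hb hc a ha => by rw [mul_add]; exact P.add_mem (hb a ha) (hc a ha))
    (fun {b} hb a ha => by rw [mul_neg]; exact P.neg_mem (hb a ha))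
    (fun {r b} hb a ha => by rw [← mul_assoc]; exact hb _ (I.mul_mem_right _ _ ha))
    (fun {b r} hb a ha => by rw [← mul_assoc]; exact P.mul_mem_right _ _ (hb a ha))
  have hJ : ∀ b, b ∈ J ↔ ∀ a ∈ I, a * b ∈ P := fun b => TwoSidedIdeal.mem_mk' _ _ _ _ _ _ _
  rcases hP.2 I J fun a ha b hb => (hJ b).1 hb a ha with h | h
  · exact h ((hI x).2 hx)
  · exact h ((hJ x).2 fun a ha => by simpa using (hI a).1 ha 1)

theorem mem_primeRadical {x : R} :
    x ∈ primeRadical R ↔ ∀ P : TwoSidedIdeal R, IsPrimeTwoSided P → x ∈ P := by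
  rw [primeRadical, TwoSidedIdeal.mem_sInf]
  rfl

theorem isSemiprimeTwoSided_primeRadical : IsSemiprimeTwoSided (primeRadical R) := by
  intro x hx
  rw [mem_primeRadical]
  exact fun P hP => hP.isSemiprime x fun r => mem_primeRadical.1 (hx r) P hP

theorem IsPrimeTwoSided.exists_isMinimalPrimeTwoSided_le {P : TwoSidedIdeal R}
    (hP : IsPrimeTwoSided P) : ∃ Q ≤ P, IsMinimalPrimeTwoSided Q := by
  have hchains : ∀ c ⊆ {Q : (TwoSidedIdeal R)ᵒᵈ | IsPrimeTwoSided (OrderDual.ofDual Q)},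
      IsChain (· ≤ ·) c → ∀ Q₀ ∈ c,
        ∃ ub ∈ {Q : (TwoSidedIdeal R)ᵒᵈ | IsPrimeTwoSided (OrderDual.ofDual Q)},
          ∀ Q ∈ c, Q ≤ ub := by
    intro c hc hchain Q₀ hQ₀
    let c' : Set (TwoSidedIdeal R) := {Q | OrderDual.toDual Q ∈ c}
    -- Zorn in the reversed order: the intersection of a chain of primes is prime.
    refine ⟨OrderDual.toDual (sInf c'), ⟨fun htop => ?_, fun I J hIJ => ?_⟩, fun Q hQ => ?_⟩
    · have h1 : sInf c' ≤ OrderDual.ofDual Q₀ := sInf_le hQ₀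
      exact (hc hQ₀).1 (top_le_iff.1 (htop ▸ h1))
    · by_contra! hcon
      obtain ⟨hI, hJ⟩ := hcon
      obtain ⟨Q₁, hQ₁, hI⟩ : ∃ Q ∈ c', ¬ I ≤ Q := by
        by_contra! h
        exact hI (le_sInf h)
      obtain ⟨Q₂, hQ₂, hJ⟩ : ∃ Q ∈ c', ¬ J ≤ Q := by
        by_contra! h
        exact hJ (le_sInf h)
      have hmem : ∀ Q ∈ c', I ≤ Q ∨ J ≤ Q := fun Q hQ =>
        (hc hQ).2 I J fun x hx y hy => (sInf_le hQ : sInf c' ≤ Q) (hIJ x hx y hy)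
      rcases hchain.total hQ₁ hQ₂ with h | h
      · have h' : Q₂ ≤ Q₁ := h
        rcases hmem Q₂ hQ₂ with h2 | h2
        · exact hI (h2.trans h')
        · exact hJ h2
      · have h' : Q₁ ≤ Q₂ := h
        rcases hmem Q₁ hQ₁ with h2 | h2
        · exact hI h2
        · exact hJ (h2.trans h')
    · exact (sInf_le hQ : sInf c' ≤ OrderDual.ofDual Q)
  obtain ⟨Q, hQP, hQ⟩ := zorn_le_nonempty₀ (α := (TwoSidedIdeal R)ᵒᵈ) _ hchains
    (OrderDual.toDual P) hP
  exact ⟨OrderDual.ofDual Q, hQP, hQ.prop, fun P' hP' hle => hQ.2 hP' hle⟩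

theorem TwoSidedIdeal.mk_eq_zero_iff {Q : TwoSidedIdeal R} {x : R} :
    Q.ringCon.mk' x = 0 ↔ x ∈ Q := by
  rw [TwoSidedIdeal.mem_iff]
  exact RingCon.eq Q.ringCon

theorem devLE_one_toRight_of_isSemiprime {Q : TwoSidedIdeal R} (hQ : IsSemiprimeTwoSided Q)
    {α : WithBot Ordinal.{v}} (hR : DevLE α (⊥ : Submodule Rᵐᵒᵖ R) ⊤)
    (hacc : LeftACCReg Q.ringCon.Quotient) (hmax : MaximalRightIdealsPrincipal R) :
    DevLE (1 : WithBot Ordinal.{v}) Q.toRight ⊤ := by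
  have hf : Function.Surjective Q.ringCon.mk' := RingCon.mk'_surjective Q.ringCon
  refine (devLE_comapRight_bot hf (devLE_one_of_semiprime (fun y hy => ?_) (hR.of_surjective hf)
    hacc (hmax.of_surjective hf))).sub (fun x hx => ?_) le_rfl
  · obtain ⟨x, rfl⟩ := hf y
    refine TwoSidedIdeal.mk_eq_zero_iff.2 (hQ x fun r => TwoSidedIdeal.mk_eq_zero_iff.1 ?_)
    rw [map_mul, map_mul]
    exact hy _
  · exact TwoSidedIdeal.mk_eq_zero_iff.1 hx

theorem devLE_one_of_forall_isPrimeTwoSided {α : WithBot Ordinal.{v}}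
    (hR : DevLE α (⊥ : Submodule Rᵐᵒᵖ R) ⊤)
    (hP : ∀ P : TwoSidedIdeal R, IsPrimeTwoSided P →
      DevLE (1 : WithBot Ordinal.{v}) P.toRight ⊤) :
    DevLE (1 : WithBot Ordinal.{v}) (⊥ : Submodule Rᵐᵒᵖ R) ⊤ := by
  let T : Submodule Rᵐᵒᵖ R :=
    { carrier := {x | DevLE (1 : WithBot Ordinal.{v}) ⊥ (Submodule.span Rᵐᵒᵖ {x})}
      zero_mem' := by
        change DevLE _ _ _
        rw [Submodule.span_zero_singleton]
        exact devLE_refl _ _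
      add_mem' := fun {x y} hx hy => by
        have h : DevLE (1 : WithBot Ordinal.{v}) ⊥
            (Submodule.span Rᵐᵒᵖ {x} ⊔ Submodule.span Rᵐᵒᵖ {y}) :=
          DevLE.trans bot_le le_sup_left hx (DevLE.sup_right hy bot_le bot_le)
        refine h.sub le_rfl ?_
        rw [Submodule.span_singleton_le_iff_mem]
        exact Submodule.add_mem_sup (Submodule.mem_span_singleton_self x)
          (Submodule.mem_span_singleton_self y)
      smul_mem' := fun r x hx => DevLE.sub hx le_rfl (by
        rw [Submodule.span_singleton_le_iff_mem]
        exact Submodule.smul_mem _ _ (Submodule.mem_span_singleton_self x)) }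
  have hT : DevLE (1 : WithBot Ordinal.{v}) ⊥ T := by
    refine devLE_one_of_locDevLE bot_le ⟨α, hR.sub le_rfl le_top⟩ fun x hx => ?_
    rw [bot_sup_eq]
    exact hx
  rcases eq_or_ne T ⊤ with htop | hne
  · rwa [htop] at hT
  exfalso
  have : Nontrivial (R ⧸ T) := Submodule.Quotient.nontrivial_iff.2 hne
  have hM : DevLE α (⊥ : Submodule Rᵐᵒᵖ (R ⧸ T)) ⊤ :=
    DevLE.of_strictMonoOn (f := Submodule.comap T.mkQ)
      ((Submodule.comap_strictMono_of_surjective T.mkQ_surjective).strictMonoOn _)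
      (hR.sub bot_le le_top)
  obtain ⟨P, hPprime, y, hy0, hy⟩ := exists_isPrimeTwoSided_annihilates hR hM
  obtain ⟨x, rfl⟩ := T.mkQ_surjective y
  refine hy0 ((Submodule.Quotient.mk_eq_zero T).2 ?_)
  have h1 : DevLE (1 : WithBot Ordinal.{v}) T (T ⊔ Submodule.span Rᵐᵒᵖ {x}) :=
    devLE_sup_span (hP P hPprime) fun r hr => by
      have := hy r hr
      rw [← map_smul] at this
      exact (Submodule.Quotient.mk_eq_zero T).1 this
  exact (DevLE.trans bot_le le_sup_left hT h1).sub le_rfl le_sup_right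

end TwoSided

/-! ### Noetherian rings -/

section Noetherian

/-- Noetherian induction on the lower end: a chain either reaches a and stops, or has all factors
inside intervals [x, b] with x > a, whose deviations are bounded by a supremum. -/
theorem exists_devLE_of_wellFoundedGT {L : Type v} [PartialOrder L] [WellFoundedGT L] (a b : L) :
    ∃ α : WithBot Ordinal.{v}, DevLE α a b := by
  induction a using WellFoundedGT.induction with
  | ind a ih =>
    choose g hg using ih
    let o : Ordinal.{v} := ⨆ x : {x // a < x}, (g x.1 x.2).unbotD 0
    have ho : ∀ x hx, g x hx < ((Order.succ o : Ordinal.{v}) : WithBot Ordinal.{v}) := by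
      intro x hx
      have h1 : (g x hx).unbotD 0 ≤ o :=
        Ordinal.le_iSup (fun x : {x // a < x} => (g x.1 x.2).unbotD 0) ⟨x, hx⟩
      refine lt_of_le_of_lt ?_ (WithBot.coe_lt_coe.2 (Order.lt_succ o))
      exact (WithBot.le_coe_unbotD _ _).trans (WithBot.coe_le_coe.2 h1)
    refine ⟨(Order.succ o : Ordinal.{v}), (devLE_iff WithBot.coe_ne_bot).2 fun c hc hcab => ?_⟩
    by_cases h : ∃ n, c n = a
    · obtain ⟨n, hn⟩ := h
      have hca : ∀ i ≥ n, c i = a := fun i hi => le_antisymm (hn ▸ hc hi) (hcab i).1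
      refine ⟨n, fun i hi => ⟨⊥, WithBot.bot_lt_coe _, ?_⟩⟩
      rw [hca i hi, hca (i + 1) (by omega)]
      exact devLE_refl _ _
    · push Not at h
      have hlt : ∀ n, a < c n := fun n => lt_of_le_of_ne (hcab n).1 (h n).symm
      exact ⟨0, fun i _ => ⟨_, ho _ (hlt (i + 1)), (hg _ (hlt (i + 1))).sub le_rfl (hcab i).2⟩⟩

theorem LeftACCReg.of_isNoetherian {R : Type*} [Ring R] [IsNoetherian R R] : LeftACCReg R := by
  intro s _ hs
  obtain ⟨n, hn⟩ := monotone_stabilizes_iff_noetherian.2 ‹IsNoetherian R R› ⟨_, hs⟩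
  exact ⟨n, fun m hm => (hn m hm).symm⟩

theorem LeftACCReg.quotient_of_isNoetherian {R : Type*} [Ring R] [IsNoetherian R R]
    (Q : TwoSidedIdeal R) : LeftACCReg Q.ringCon.Quotient :=
  have : IsNoetherianRing Q.ringCon.Quotient :=
    isNoetherianRing_of_surjective R _ Q.ringCon.mk' (RingCon.mk'_surjective Q.ringCon)
  LeftACCReg.of_isNoetherian

end Noetherian

/-! ### Conclusion -/

theorem rKdim_le_one {R : Type u} [Ring R] (hR : HasRightKdim R)
    (hmax : MaximalRightIdealsPrincipal R)
    (hacc : LeftACCReg (primeRadical R).ringCon.Quotient ∨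
      ∀ P : TwoSidedIdeal R, IsMinimalPrimeTwoSided P → LeftACCReg P.ringCon.Quotient) :
    rKdim R hR ≤ 1 := by
  obtain ⟨α, hα⟩ := id hR
  rw [krullClass_iff_devLE] at hα
  have h1 : KrullClass Rᵐᵒᵖ (1 : WithBot Ordinal.{u}) R := by
    rw [krullClass_iff_devLE]
    refine devLE_one_of_forall_isPrimeTwoSided hα fun P hP => ?_
    rcases hacc with hacc | hacc
    · exact (devLE_one_toRight_of_isSemiprime isSemiprimeTwoSided_primeRadical hα hacc hmax).sub
        (fun x hx => mem_primeRadical.1 hx P hP) le_rfl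
    · obtain ⟨Q, hQP, hQ⟩ := hP.exists_isMinimalPrimeTwoSided_le
      exact (devLE_one_toRight_of_isSemiprime hQ.prop.isSemiprime hα (hacc Q hQ) hmax).sub
        (fun x hx => hQP hx) le_rfl
  exact not_lt.1 (WellFounded.not_lt_min wellFounded_lt (s := {α | KrullClass Rᵐᵒᵖ α R}) h1)

theorem corollary7p6 (R : Type u) [Ring R] (hmax : MaximalRightIdealsPrincipal R) :
    (∀ hR : HasRightKdim R,
      (LeftACCReg (primeRadical R).ringCon.Quotient ∨
        ∀ P : TwoSidedIdeal R, IsMinimalPrimeTwoSided P → LeftACCReg P.ringCon.Quotient) →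
      rKdim R hR ≤ 1) ∧
    (IsNoetherian R R → IsNoetherian Rᵐᵒᵖ R → ∃ hR : HasRightKdim R, rKdim R hR ≤ 1) := by
  refine ⟨fun hR hacc => rKdim_le_one hR hmax hacc, fun _ _ => ?_⟩
  obtain ⟨α, hα⟩ := exists_devLE_of_wellFoundedGT (⊥ : Submodule Rᵐᵒᵖ R) ⊤
  have hR : HasRightKdim R := ⟨α, krullClass_iff_devLE.{u, u} (S := Rᵐᵒᵖ) α |>.2 hα⟩
  exact ⟨hR, rKdim_le_one hR hmax (Or.inl (LeftACCReg.quotient_of_isNoetherian _))⟩
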